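/- For $j\ge 1$ and $0\le k\le 2^j-1$ put $$A_{j,k}=\begin{pmatrix}4^j&0\\0&2^j\end{pmatrix}\begin{pmatrix}\cos\frac{2k\pi}{2^j}&-\sin\frac{2k\pi}{2^j}\\ \sin\frac{2k\pi}{2^j}&\cos\frac{2k\pi}{2^j}\end{pmatrix},\qquad B_{j,k}=(A_{j,k}^*)^{-1}.$$ For $\varphi_0,\varphi\in L^2(\mathbb R^2)$ and a lattice $\Lambda=P\mathbb Z^2$, with $P\in\mathbb R^{2\times 2}$ invertible, let $|\Lambda|=|\det P|$, let the lattice parameters $a,b>0$ be the singular values of $P$, and let $\mathcal C_\Lambda$ be the family consisting of $\varphi_0(\cdot-\lambda)$, $\lambda\in\Lambda$, and of $\varphi_{j,k,\lambda}(x)=8^{j/2}\varphi(A_{j,k}x-\lambda)$, $\lambda\in\Lambda$, $j\ge1$, $0\le k\le 2^j-1$. A family $(e_i)$ in $L^2(\mathbb R^2)$ is a frame if there are $0<\alpha\le\beta<\infty$ with $\alpha\|f\|_2^2\le\sum_i|\langle f,e_i\rangle|^2\le\beta\|f\|_2^2$ for all $f\in L^2(\mathbb R^2)$. The Fourier transform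 is $\hat f(\xi)=\int f(x)e^{-2\pi i\,\xi\cdot x}\,dx$, extended to $L^2(\mathbb R^2)$. **Theorem.** Let $\delta>0$ and $\varsigma>2$. There is $\tau>0$, depending only on $\delta$ and $\varsigma$, and for every $K>0$ there is $C>0$, depending only on $\delta$, $\varsigma$ and $K$, such that the following holds. Let $\varphi_0,\varphi\in L^2(\mathbb R^2)$ and $A,B\in\mathbb R$ satisfy, for almost every $\xi=(\xi_1,\xi_2)\in\mathbb R^2$, $$0<A\le|\widehat{\varphi_0}(\xi)|^2+\sum_{j\ge1}\sum_{k=0}^{2^j-1}|\widehat\varphi(B_{j,k}\xi)|^2\le B,$$ $$|\widehat{\varphi_0}(\xi)|\le K e^{-\delta|\xi|^2},\qquad |\widehat\varphi(\xi)|\le K\min(1,|\xi_1|^{\varsigma})\,e^{-\delta|\xi|^2}.$$ 1. For every lattice $\Lambda=P\mathbb Z^2$ with parameters $a,b$ such that $$\kappa:=e^{-\tau/a^2}+e^{-\tau/b^2}\le CA,$$ the family $\mathcal C_\Lambda$ is a frame of $L^2(\mathbb R^2)$, and for all $f\in L^2(\mathbb R^2)$ $$|\Lambda|^{-1}(A-C^{-1}\kappa)\|f\|_2^2\le\sum_{e\in\mathcal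 C_\Lambda}|\langle f,e\rangle|^2\le|\Lambda|^{-1}(B+C^{-1}\kappa)\|f\|_2^2 .$$ 2. As $a,b\to0^+$, the ratio $\dfrac{|\Lambda|^{-1}(B+C^{-1}\kappa)}{|\Lambda|^{-1}(A-C^{-1}\kappa)}$ of these bounds tends to $B/A$. -/

import Mathlib

open MeasureTheory Filter Topology
open scoped FourierTransform ENNReal

namespace Wavepacket

noncomputable section

/-- The Euclidean plane. -/
abbrev Plane : Type := EuclideanSpace ℝ (Fin 2)

/-- The Hilbert space of square-integrable complex functions on the plane. -/
abbrev L2 : Type := Lp ℂ 2 (volume : Measure Plane)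

/-- The action `x ↦ M x` of a real matrix on the plane. -/
abbrev act (M : Matrix (Fin 2) (Fin 2) ℝ) : Plane →ₗ[ℝ] Plane := Matrix.toEuclideanLin M

/-- The parabolic dilation `diag (4 ^ j, 2 ^ j)`. -/
def parabolic (j : ℕ) : Matrix (Fin 2) (Fin 2) ℝ := !![4 ^ j, 0; 0, 2 ^ j]

/-- The rotation matrix of angle `θ`. -/
def rotation (θ : ℝ) : Matrix (Fin 2) (Fin 2) ℝ :=
  !![Real.cos θ, -Real.sin θ; Real.sin θ, Real.cos θ]

/-- The matrix `A_{j,k}`: a parabolic dilation composed with the rotation of angle `2 k π / 2 ^ j`. -/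
def matA (j k : ℕ) : Matrix (Fin 2) (Fin 2) ℝ :=
  parabolic j * rotation (2 * k * Real.pi / 2 ^ j)

/-- The matrix `B_{j,k}`, the inverse of the adjoint of `A_{j,k}`. -/
def matB (j k : ℕ) : Matrix (Fin 2) (Fin 2) ℝ := ((matA j k).transpose)⁻¹

/-- Pairs `(j, k)` with `1 ≤ j` and `0 ≤ k ≤ 2 ^ j - 1`. -/
abbrev ScaleAngle : Type := Σ j : ℕ+, Fin (2 ^ (j : ℕ))

theorem det_matA (j k : ℕ) : (matA j k).det = 8 ^ j := by
  have h : Real.cos (2 * k * Real.pi / 2 ^ j) * Real.cos (2 * k * Real.pi / 2 ^ j)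
      + Real.sin (2 * k * Real.pi / 2 ^ j) * Real.sin (2 * k * Real.pi / 2 ^ j) = 1 := by
    have := Real.cos_sq_add_sin_sq (2 * k * Real.pi / 2 ^ j)
    nlinarith
  simp only [matA, parabolic, rotation, Matrix.det_mul, Matrix.det_fin_two_of]
  rw [mul_zero, sub_zero, neg_mul, sub_neg_eq_add, h, mul_one, ← mul_pow]
  norm_num

theorem memLp_comp_act {M : Matrix (Fin 2) (Fin 2) ℝ} (hM : M.det ≠ 0) {f : Plane → ℂ}
    (hf : MemLp f 2 volume) : MemLp (fun x => f (act M x)) 2 volume := by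
  have hdet : LinearMap.det (act M) ≠ 0 := by
    simpa [act, Matrix.toLpLin_eq_toLin] using hM
  have hmap := Measure.map_linearMap_addHaar_eq_smul_addHaar (volume : Measure Plane) hdet
  have hmeas : Measurable (act M) := (LinearMap.continuous_of_finiteDimensional _).measurable
  refine MemLp.comp_of_map (f := act M) (g := f) ?_ hmeas.aemeasurable
  rw [hmap]
  exact hf.smul_measure ENNReal.ofReal_ne_top

theorem memLp_comp_sub (y : Plane) {f : Plane → ℂ} (hf : MemLp f 2 volume) :
    MemLp (fun x => f (x - y)) 2 volume :=
  hf.comp_measurePreserving (measurePreserving_sub_right volume y)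

/-- The coarse-scale packet `x ↦ φ₀ (x - y)`. -/
def coarsePacket (φ₀ : L2) (y : Plane) : L2 :=
  MemLp.toLp (fun x => φ₀ (x - y)) (memLp_comp_sub y (Lp.memLp φ₀))

theorem memLp_packet (φ : L2) (j k : ℕ) (y : Plane) :
    MemLp (fun x => (((8 : ℝ) ^ ((j : ℝ) / 2) : ℝ) : ℂ) * φ (act (matA j k) x - y)) 2 volume :=
  (memLp_comp_act (M := matA j k) (by rw [det_matA]; positivity)
    (memLp_comp_sub y (Lp.memLp φ))).const_mul _

/-- The wavepacket `x ↦ 8 ^ (j / 2) φ (A_{j,k} x - y)`. -/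
def packet (φ : L2) (j k : ℕ) (y : Plane) : L2 :=
  MemLp.toLp (fun x => (((8 : ℝ) ^ ((j : ℝ) / 2) : ℝ) : ℂ) * φ (act (matA j k) x - y))
    (memLp_packet φ j k y)

/-- The lattice `P ℤ²`. -/
def lattice (P : Matrix (Fin 2) (Fin 2) ℝ) : Set Plane :=
  Set.range fun n : Fin 2 → ℤ => act P (WithLp.toLp 2 fun i => (n i : ℝ))

/-- The volume `|det P|` of the lattice `P ℤ²`. -/
def latticeVolume (P : Matrix (Fin 2) (Fin 2) ℝ) : ℝ := |P.det|

/-- The lattice parameter `a`: the larger of the two singular values of `P`. -/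
def paramA (P : Matrix (Fin 2) (Fin 2) ℝ) : ℝ := (act P).singularValues 0

/-- The lattice parameter `b`: the smaller of the two singular values of `P`. -/
def paramB (P : Matrix (Fin 2) (Fin 2) ℝ) : ℝ := (act P).singularValues 1

/-- The wavepacket system over the lattice `Λ = P ℤ²`: all coarse-scale packets centred at points
of `Λ` and all packets with `j ≥ 1`, `0 ≤ k ≤ 2 ^ j - 1` and a point of `Λ`. -/
def system (φ₀ φ : L2) (P : Matrix (Fin 2) (Fin 2) ℝ) :
    lattice P ⊕ (ScaleAngle × lattice P) → L2
  | Sum.inl y => coarsePacket φ₀ y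
  | Sum.inr (⟨j, k⟩, y) => packet φ j k y

/-- The family `e` satisfies the frame inequalities with constants `α` and `β`. -/
def HasFrameBounds {ι H : Type*} [NormedAddCommGroup H] [InnerProductSpace ℂ H]
    (e : ι → H) (α β : ℝ) : Prop :=
  ∀ f : H, Summable (fun i => ‖inner ℂ f (e i)‖ ^ 2) ∧
    α * ‖f‖ ^ 2 ≤ ∑' i, ‖inner ℂ f (e i)‖ ^ 2 ∧
    ∑' i, ‖inner ℂ f (e i)‖ ^ 2 ≤ β * ‖f‖ ^ 2

/-- A frame of a Hilbert space: the frame inequalities hold with positive constants. -/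
def IsFrame {ι H : Type*} [NormedAddCommGroup H] [InnerProductSpace ℂ H] (e : ι → H) : Prop :=
  ∃ α β : ℝ, 0 < α ∧ 0 < β ∧ HasFrameBounds e α β

/-- The covering function
`|φ₀^ (ξ)|² + ∑_{j ≥ 1} ∑_{k < 2 ^ j} |φ^ (B_{j,k} ξ)|²`, with values in `[0, ∞]`. -/
def coveringSum (φ₀ φ : L2) (ξ : Plane) : ℝ≥0∞ :=
  ‖(𝓕 φ₀ : L2) ξ‖ₑ ^ 2 +
    ∑' j : ℕ+, ∑ k : Fin (2 ^ (j : ℕ)), ‖(𝓕 φ : L2) (act (matB j k) ξ)‖ₑ ^ 2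

/-- The covering condition with constants `A` and `B`. -/
def Covering (φ₀ φ : L2) (A B : ℝ) : Prop :=
  0 < A ∧ ∀ᵐ ξ : Plane, ENNReal.ofReal A ≤ coveringSum φ₀ φ ξ ∧
    coveringSum φ₀ φ ξ ≤ ENNReal.ofReal B

/-- Gaussian decay of the Fourier transform of the coarse window, with implied constant `K`. -/
def CoarseDecay (φ₀ : L2) (δ K : ℝ) : Prop :=
  ∀ᵐ ξ : Plane, ‖(𝓕 φ₀ : L2) ξ‖ ≤ K * Real.exp (-δ * ‖ξ‖ ^ 2)

/-- Gaussian decay of the Fourier transform of the window, together with vanishing of order `ς`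
in the first frequency variable, with implied constant `K`. -/
def WindowDecay (φ : L2) (δ ς K : ℝ) : Prop :=
  ∀ᵐ ξ : Plane, ‖(𝓕 φ : L2) ξ‖ ≤ K * (min 1 (|ξ 0| ^ ς) * Real.exp (-δ * ‖ξ‖ ^ 2))

/-- The quantity `κ = exp (-τ / a²) + exp (-τ / b²)` of the lattice `P ℤ²`. -/
def kappa (τ : ℝ) (P : Matrix (Fin 2) (Fin 2) ℝ) : ℝ :=
  Real.exp (-τ / paramA P ^ 2) + Real.exp (-τ / paramB P ^ 2)

/-- The lower frame bound `|Λ|⁻¹ (A - C⁻¹ κ)`. -/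
def lowerBound (A C τ : ℝ) (P : Matrix (Fin 2) (Fin 2) ℝ) : ℝ :=
  (latticeVolume P)⁻¹ * (A - C⁻¹ * kappa τ P)

/-- The upper frame bound `|Λ|⁻¹ (B + C⁻¹ κ)`. -/
def upperBound (B C τ : ℝ) (P : Matrix (Fin 2) (Fin 2) ℝ) : ℝ :=
  (latticeVolume P)⁻¹ * (B + C⁻¹ * kappa τ P)

/-- The filter of invertible matrices `P` whose lattice parameters `a`, `b` tend to `0`. -/
def fineLattices : Filter (Matrix (Fin 2) (Fin 2) ℝ) :=
  comap (fun P => (paramA P, paramB P)) (𝓝 (0, 0)) ⊓ 𝓟 {P | P.det ≠ 0}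

end

end Wavepacket

/-! Fix M = A_{j,k}, or M = 1 for the coarse packets. By Plancherel and the substitution ξ = Mᵀ P⁻ᵀ
u, the coefficients of f against |det M|^{1/2} φ(M · - P n) are, up to a constant factor, the
Fourier coefficients of the ℤ²-periodization of H(u) = conj f^(ξ) φ^(M⁻ᵀ ξ) (`inner_affinePacket`,
`mFourierCoeff_periodize`). Parseval turns the sum of their squares into the integral of |∑_m H(u +
m)|² over the unit cube. The diagonal part of this square gives |Λ|⁻¹ ∫ |f^|² |φ^(M⁻ᵀ ·)|². Summed
over all M, it is |Λ|⁻¹ ∫ |f^|² times the covering function, hence lies between |Λ|⁻¹ A ‖f‖² and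
|Λ|⁻¹ B ‖f‖² (`energy_bounds`).

The rest is an error, bounded by the correlations of |H| with its translates by l ≠ 0. Such a
translation moves the argument of φ^ by the dual vector μ = P⁻ᵀ l, of length at least |l| / a.
Gaussian decay at both points yields a factor exp(-δ |μ|² / 4) and still leaves an envelope at
either point (`ae_mul_shift_le`). The sum over l ≠ 0 is then O(exp(-τ / a²)) with τ = δ / 8,
provided a² ≤ τ; only the larger singular value a matters.

The errors can be summed over (j, k) because the envelopes at B_{j,k} ξ have a sum bounded uniformly
in ξ (`tsum_envelope_act_matB_le`): the Gaussian makes the angles summable at each scale, and ς > 2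
makes the scales summable. The total error is a constant times |Λ|⁻¹ K² exp(-τ / a²) ‖f‖²
(`totalRemainder_le`). -/

namespace Wavepacket

noncomputable section

/-! ### Parseval for periodizations, with off-diagonal error -/

section periodization

attribute [local instance] instMeasureSpaceUnitAddCircle

variable {d : Type*}

/-- The integer vector `m`, seen as a real vector. -/
def intVec (m : d → ℤ) : d → ℝ := fun i => (m i : ℝ)

theorem intVec_add (m n : d → ℤ) : intVec (m + n) = intVec m + intVec n := by
  ext i; simp [intVec]

/-- The half-open unit cube. -/
def unitCube (d : Type*) : Set (d → ℝ) := {x | ∀ i, x i ∈ Set.Ioc (0 : ℝ) (0 + 1)}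

/-- The translate of the unit cube by `m`. -/
def cubeAt (m : d → ℤ) : Set (d → ℝ) := (fun x => x - intVec m) ⁻¹' unitCube d

/-- The cubes are open on the left and closed on the right, so the ceiling rather than the floor
selects the index. -/
theorem mem_cubeAt {m : d → ℤ} {x : d → ℝ} : x ∈ cubeAt m ↔ m = fun i => ⌈x i⌉ - 1 := by
  simp only [cubeAt, unitCube, intVec, Set.mem_preimage, Set.mem_ofPred_eq, Pi.sub_apply,
    funext_iff]
  refine forall_congr' fun i => ?_
  rw [eq_sub_iff_add_eq, eq_comm, Int.ceil_eq_iff, Set.mem_Ioc]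
  push_cast
  constructor <;> rintro ⟨h1, h2⟩ <;> constructor <;> linarith

theorem preimage_cubeAt (m : d → ℤ) : (fun x => x + intVec m) ⁻¹' cubeAt m = unitCube d := by
  ext x; simp [cubeAt]

theorem measurableEmbedding_add_intVec (m : d → ℤ) :
    MeasurableEmbedding fun x : d → ℝ => x + intVec m :=
  (MeasurableEquiv.addRight (intVec m)).measurableEmbedding

/-- The representative in the unit cube of a point of the torus. -/
def torusSection (x : UnitAddTorus d) : d → ℝ :=
  (UnitAddTorus.measurableEquivPiIoc (fun _ : d => (0 : ℝ)) x).1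

theorem measurable_torusSection : Measurable (torusSection (d := d)) :=
  measurable_subtype_coe.comp (MeasurableEquiv.measurable _)

theorem torusSection_coe {x : d → ℝ} (hx : x ∈ unitCube d) :
    torusSection (fun i => (x i : UnitAddCircle)) = x := by
  have := (UnitAddTorus.measurableEquivPiIoc (fun _ : d => (0 : ℝ))).apply_symm_apply ⟨x, hx⟩
  rw [UnitAddTorus.coe_symm_measurableEquivPiIoc_apply] at this
  exact congrArg Subtype.val this

theorem pairwise_disjoint_cubeAt :
    Pairwise (Function.onFun Disjoint (cubeAt : (d → ℤ) → Set (d → ℝ))) := by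
  intro m n hmn
  refine Set.disjoint_left.2 fun x hx hx' => hmn ?_
  rw [mem_cubeAt.1 hx, mem_cubeAt.1 hx']

theorem iUnion_cubeAt : (⋃ m : d → ℤ, cubeAt m) = Set.univ :=
  Set.eq_univ_of_forall fun _ => Set.mem_iUnion.2 ⟨_, mem_cubeAt.2 rfl⟩

variable [Fintype d]

theorem measurableSet_unitCube : MeasurableSet (unitCube d) :=
  MeasurableSet.univ_pi' fun _ => measurableSet_Ioc

theorem measurableSet_cubeAt (m : d → ℤ) : MeasurableSet (cubeAt m) :=
  measurableSet_unitCube.preimage (measurable_id.sub_const _)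

theorem lintegral_eq_tsum_unitCube (f : (d → ℝ) → ℝ≥0∞) :
    ∫⁻ x, f x = ∑' m : d → ℤ, ∫⁻ x in unitCube d, f (x + intVec m) := by
  rw [← setLIntegral_univ, ← iUnion_cubeAt,
    lintegral_iUnion measurableSet_cubeAt pairwise_disjoint_cubeAt]
  refine tsum_congr fun m => ?_
  rw [← (measurePreserving_add_right volume (intVec m)).setLIntegral_comp_preimage_emb
    (measurableEmbedding_add_intVec m), preimage_cubeAt]

theorem integral_eq_tsum_unitCube {f : (d → ℝ) → ℂ} (hf : Integrable f) :
    ∫ x, f x = ∑' m : d → ℤ, ∫ x in unitCube d, f (x + intVec m) := by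
  rw [← setIntegral_univ, ← iUnion_cubeAt,
    integral_iUnion measurableSet_cubeAt pairwise_disjoint_cubeAt hf.integrableOn]
  refine tsum_congr fun m => ?_
  rw [← (measurePreserving_add_right volume (intVec m)).setIntegral_preimage_emb
    (measurableEmbedding_add_intVec m), preimage_cubeAt]

/-- The periodization of a function on `ℝᵈ`. -/
def periodize (H : (d → ℝ) → ℂ) (x : d → ℝ) : ℂ := ∑' m : d → ℤ, H (x + intVec m)

theorem measurable_periodize {H : (d → ℝ) → ℂ} (hH : Measurable H) : Measurable (periodize H) :=
  Measurable.tsum fun m => hH.comp (measurable_id.add_const (intVec m))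

/-- The character `x ↦ exp (-2 π i n · x)` of `ℝᵈ`. -/
def char (n : d → ℤ) (x : d → ℝ) : ℂ := UnitAddTorus.mFourier (-n) fun i => (x i : UnitAddCircle)

theorem char_add_intVec (n m : d → ℤ) (x : d → ℝ) : char n (x + intVec m) = char n x := by
  unfold char
  congr 1
  ext i
  simp [intVec]

theorem continuous_char (n : d → ℤ) : Continuous (char n) :=
  (UnitAddTorus.mFourier (-n)).continuous.comp
    (continuous_pi fun i => (AddCircle.continuous_mk' 1).comp (continuous_apply i))

theorem enorm_char (n : d → ℤ) (x : d → ℝ) : ‖char n x‖ₑ = 1 := by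
  have : ‖char n x‖ = 1 := by
    simp only [char, UnitAddTorus.mFourier, fourier_apply, ContinuousMap.coe_mk, norm_prod,
      Circle.norm_coe, Finset.prod_const_one]
  rw [← ofReal_norm, this, ENNReal.ofReal_one]

theorem lintegral_torus_comp_section (F : (d → ℝ) → ℝ≥0∞) :
    ∫⁻ x : UnitAddTorus d, F (torusSection x) = ∫⁻ x in unitCube d, F x := by
  rw [UnitAddTorus.lintegral_preimage _ (fun _ => 0)]
  refine setLIntegral_congr_fun measurableSet_unitCube fun x hx => ?_
  simp only [torusSection_coe hx]

theorem lintegral_unitCube_tsum {F : (d → ℝ) → ℝ≥0∞} (hF : Measurable F) :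
    ∫⁻ x in unitCube d, ∑' m : d → ℤ, F (x + intVec m) = ∫⁻ x, F x := by
  rw [lintegral_eq_tsum_unitCube, lintegral_tsum]
  exact fun m => (hF.comp (measurable_id.add_const _)).aemeasurable

/-- The character is periodic, so its integral against H over the whole space folds onto one cube;
integrability of H permits exchanging sum and integral. -/
theorem mFourierCoeff_periodize {H : (d → ℝ) → ℂ} (hH : Measurable H) (hi : Integrable H)
    (n : d → ℤ) :
    UnitAddTorus.mFourierCoeff (fun x => periodize H (torusSection x)) n
      = ∫ x, char n x * H x := by
  have hi' : Integrable fun x => char n x * H x := by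
    refine hi.congr' ((continuous_char n).measurable.mul hH).aestronglyMeasurable ?_
    refine .of_forall fun x => ?_
    have := enorm_char n x
    rw [← ofReal_norm, ENNReal.ofReal_eq_one] at this
    rw [norm_mul, this, one_mul]
  have hm : ∀ m : d → ℤ, Measurable fun x => char n x * H (x + intVec m) := fun m =>
    (continuous_char n).measurable.mul (hH.comp (measurable_id.add_const _))
  rw [UnitAddTorus.mFourierCoeff_eq_integral _ _ (fun _ => 0), integral_eq_tsum_unitCube hi']
  simp only [char_add_intVec]
  rw [← integral_tsum (fun m => (hm m).aestronglyMeasurable)]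
  · refine setIntegral_congr_fun measurableSet_unitCube fun x hx => ?_
    simp only [torusSection_coe hx, periodize, smul_eq_mul]
    rw [tsum_mul_left]; rfl
  · simp only [enorm_mul, enorm_char, one_mul]
    rw [← lintegral_eq_tsum_unitCube fun x => ‖H x‖ₑ]
    exact hi.2.ne

theorem tsum_enorm_sq_mFourierCoeff {g : UnitAddTorus d → ℂ} (hg : MemLp g 2) :
    ∑' n, ‖UnitAddTorus.mFourierCoeff g n‖ₑ ^ 2 = ∫⁻ x, ‖g x‖ₑ ^ 2 := by
  have h := UnitAddTorus.hasSum_sq_mFourierCoeff (hg.toLp g)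
  have hc : ∀ n, UnitAddTorus.mFourierCoeff (hg.toLp g) n = UnitAddTorus.mFourierCoeff g n :=
    fun n => integral_congr_ae (by filter_upwards [hg.coeFn_toLp] with x hx; rw [hx])
  have hi : ∫ t, ‖(hg.toLp g : UnitAddTorus d → ℂ) t‖ ^ 2 = ∫ t, ‖g t‖ ^ 2 :=
    integral_congr_ae (by filter_upwards [hg.coeFn_toLp] with x hx; rw [hx])
  simp only [hc, hi] at h
  have hint : Integrable fun t => ‖g t‖ ^ 2 := hg.integrable_norm_pow (by norm_num)
  have e : ∀ z : ℂ, ‖z‖ₑ ^ 2 = ENNReal.ofReal (‖z‖ ^ 2) := fun z => by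
    rw [ENNReal.ofReal_pow (norm_nonneg _), ofReal_norm]
  simp only [e]
  rw [← ENNReal.ofReal_tsum_of_nonneg (fun _ => by positivity) h.summable, h.tsum_eq,
    ofReal_integral_eq_lintegral_ofReal hint (.of_forall fun _ => by positivity)]

section pointwise

variable {ι : Type*} (h : ι → ℂ)

theorem enorm_tsum_sq_le : ‖∑' m, h m‖ₑ ^ 2 ≤ ∑' m, ∑' l, ‖h m‖ₑ * ‖h l‖ₑ := by
  simp only [ENNReal.tsum_mul_left, ENNReal.tsum_mul_right]
  rw [← sq]
  gcongr
  exact enorm_tsum_le_tsum_enorm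

/-- With S the full sum, |h_m|² = Re (h_m conj S) + Re (h_m conj (h_m - S)). The first terms add up
to |S|², and |S - h_m| is at most the sum of the other |h_l|. The error stands on the right because
subtraction in [0, ∞] truncates. -/
theorem tsum_enorm_sq_le [DecidableEq ι] (hs : ∑' m, ‖h m‖ₑ ≠ ∞) :
    ∑' m, ‖h m‖ₑ ^ 2 ≤
      ‖∑' m, h m‖ₑ ^ 2 + ∑' m, ∑' l, if l = m then 0 else ‖h m‖ₑ * ‖h l‖ₑ := by
  have hs1 : Summable fun m => ‖h m‖ := by
    have := ENNReal.summable_toReal hs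
    simpa only [toReal_enorm] using this
  have hsh : Summable h := hs1.of_norm
  set S := ∑' m, h m with hS
  have hsp : ∀ m, Summable fun l => if l = m then 0 else ‖h l‖ := fun m =>
    Summable.of_nonneg_of_le (fun l => by split_ifs <;> positivity)
      (fun l => by split_ifs <;> simp) hs1
  set p : ι → ℝ := fun m => ∑' l, if l = m then 0 else ‖h l‖ with hp
  have hp0 : ∀ m, 0 ≤ p m := fun m => tsum_nonneg fun l => by split_ifs <;> positivity
  have hple : ∀ m, p m ≤ ∑' l, ‖h l‖ := fun m =>
    (hsp m).tsum_le_tsum (fun l => by split_ifs <;> simp) hs1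
  have hdiff : ∀ m, ‖h m - S‖ ≤ p m := fun m => by
    have h1 : S = h m + ∑' l, if l = m then 0 else h l := hsh.tsum_eq_add_tsum_ite m
    rw [h1, sub_add_cancel_left, norm_neg]
    refine (norm_tsum_le_tsum_norm ?_).trans (le_of_eq ?_)
    · simpa only [apply_ite norm, norm_zero] using hsp m
    · simp only [apply_ite norm, norm_zero, hp]
  have key : ∀ m, ‖h m‖ ^ 2 ≤ (h m * starRingEnd ℂ S).re + ‖h m‖ * p m := fun m => by
    have e : ‖h m‖ ^ 2 = (h m * starRingEnd ℂ S).re + (h m * starRingEnd ℂ (h m - S)).re := by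
      rw [← Complex.add_re, ← mul_add, ← map_add, add_sub_cancel, Complex.mul_conj,
        Complex.ofReal_re, Complex.normSq_eq_norm_sq]
    rw [e]
    gcongr
    refine (Complex.re_le_norm _).trans ?_
    rw [norm_mul, RCLike.norm_conj]
    exact mul_le_mul_of_nonneg_left (hdiff m) (norm_nonneg _)
  have hre : HasSum (fun m => (h m * starRingEnd ℂ S).re) (‖S‖ ^ 2) := by
    have := Complex.hasSum_re (hsh.hasSum.mul_right (starRingEnd ℂ S))
    rwa [← hS, Complex.mul_conj, Complex.ofReal_re, Complex.normSq_eq_norm_sq] at this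
  have hsq : Summable fun m => ‖h m‖ * p m :=
    Summable.of_nonneg_of_le (fun m => mul_nonneg (norm_nonneg _) (hp0 m))
      (fun m => mul_le_mul_of_nonneg_left (hple m) (norm_nonneg _)) (hs1.mul_right _)
  have hsum : Summable fun m => ‖h m‖ ^ 2 :=
    Summable.of_nonneg_of_le (fun _ => by positivity) key (hre.summable.add hsq)
  have real : ∑' m, ‖h m‖ ^ 2 ≤ ‖S‖ ^ 2 + ∑' m, ‖h m‖ * p m := by
    refine (hsum.tsum_le_tsum key (hre.summable.add hsq)).trans (le_of_eq ?_)
    rw [hre.summable.tsum_add hsq, hre.tsum_eq]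
  have e : ∀ z : ℂ, ‖z‖ₑ ^ 2 = ENNReal.ofReal (‖z‖ ^ 2) := fun z => by
    rw [ENNReal.ofReal_pow (norm_nonneg _), ofReal_norm]
  have e2 : ∀ m, (∑' l, if l = m then 0 else ‖h m‖ₑ * ‖h l‖ₑ) = ENNReal.ofReal (‖h m‖ * p m) := by
    intro m
    rw [ENNReal.ofReal_mul (norm_nonneg _), ENNReal.ofReal_tsum_of_nonneg
      (fun l => by split_ifs <;> positivity) (hsp m), ofReal_norm, ← ENNReal.tsum_mul_left]
    refine tsum_congr fun l => ?_
    split_ifs <;> simp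
  simp only [e, e2]
  rw [← ENNReal.ofReal_tsum_of_nonneg (fun _ => by positivity) hsum,
    ← ENNReal.ofReal_tsum_of_nonneg (fun m => mul_nonneg (norm_nonneg _) (hp0 m)) hsq,
    ← ENNReal.ofReal_add (by positivity)
      (tsum_nonneg fun m => mul_nonneg (norm_nonneg _) (hp0 m))]
  exact ENNReal.ofReal_le_ofReal real

end pointwise

/-- The sum of the correlations of `|H|` with its nonzero integer translates. -/
def offDiagonal [DecidableEq d] (H : (d → ℝ) → ℂ) : ℝ≥0∞ :=
  ∑' l : d → ℤ, if l = 0 then 0 else ∫⁻ x, ‖H x‖ₑ * ‖H (x + intVec l)‖ₑ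

theorem tsum_correlation [DecidableEq d] (H : (d → ℝ) → ℂ) :
    ∑' l : d → ℤ, ∫⁻ x, ‖H x‖ₑ * ‖H (x + intVec l)‖ₑ
      = (∫⁻ x, ‖H x‖ₑ ^ 2) + offDiagonal H := by
  rw [ENNReal.tsum_eq_add_tsum_ite 0, offDiagonal]
  have : (intVec 0 : d → ℝ) = 0 := by ext; simp [intVec]
  simp only [this, add_zero, sq]
  congr!

/-- Replacing l by l + m makes the summand a function of x + m, and the sum over m unfolds the cube
to the whole space. The weight w = 1 keeps all pairs; the indicator of l ≠ 0 keeps the off-diagonal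
ones. -/
theorem lintegral_unitCube_tsum_tsum {H : (d → ℝ) → ℂ} (hH : Measurable H)
    (w : (d → ℤ) → ℝ≥0∞) :
    ∫⁻ x in unitCube d, ∑' m : d → ℤ, ∑' l : d → ℤ,
        w (l - m) * (‖H (x + intVec m)‖ₑ * ‖H (x + intVec l)‖ₑ)
      = ∑' l : d → ℤ, w l * ∫⁻ x, ‖H x‖ₑ * ‖H (x + intVec l)‖ₑ := by
  have hm : ∀ m : d → ℤ, Measurable fun x => ‖H (x + intVec m)‖ₑ := fun m =>
    (hH.comp (measurable_id.add_const _)).enorm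
  have hF : ∀ l : d → ℤ, Measurable fun x => w l * (‖H x‖ₑ * ‖H (x + intVec l)‖ₑ) := fun l =>
    (hH.enorm.mul (hm l)).const_mul _
  have : ∀ x : d → ℝ, (∑' m : d → ℤ, ∑' l : d → ℤ,
        w (l - m) * (‖H (x + intVec m)‖ₑ * ‖H (x + intVec l)‖ₑ))
      = ∑' m : d → ℤ, (fun y => ∑' l : d → ℤ, w l * (‖H y‖ₑ * ‖H (y + intVec l)‖ₑ))
        (x + intVec m) := fun x => by
    refine tsum_congr fun m => ?_
    rw [← (Equiv.addRight m).tsum_eq]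
    refine tsum_congr fun l => ?_
    simp [intVec_add, add_assoc, add_comm (intVec l)]
  simp only [this]
  rw [lintegral_unitCube_tsum (Measurable.tsum hF), lintegral_tsum fun l => (hF l).aemeasurable]
  refine tsum_congr fun l => ?_
  exact lintegral_const_mul _ (hH.enorm.mul (hm l))

theorem lintegral_periodize_sq_le [DecidableEq d] {H : (d → ℝ) → ℂ} (hH : Measurable H) :
    ∫⁻ x in unitCube d, ‖periodize H x‖ₑ ^ 2 ≤ (∫⁻ x, ‖H x‖ₑ ^ 2) + offDiagonal H := by
  have := lintegral_unitCube_tsum_tsum hH fun _ => 1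
  simp only [one_mul] at this
  rw [← tsum_correlation, ← this]
  exact lintegral_mono fun x => enorm_tsum_sq_le _

theorem le_lintegral_periodize_sq [DecidableEq d] {H : (d → ℝ) → ℂ} (hH : Measurable H)
    (hi : Integrable H) :
    ∫⁻ x, ‖H x‖ₑ ^ 2 ≤ (∫⁻ x in unitCube d, ‖periodize H x‖ₑ ^ 2) + offDiagonal H := by
  have h1 := lintegral_unitCube_tsum_tsum hH fun l => if l = 0 then 0 else 1
  -- The pointwise inequality needs absolute convergence, which integrability of H provides almost
  -- everywhere.
  have hfin : ∀ᵐ x ∂(volume.restrict (unitCube d)), ∑' m : d → ℤ, ‖H (x + intVec m)‖ₑ < ∞ := by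
    refine ae_lt_top (Measurable.tsum fun m => (hH.comp (measurable_id.add_const _)).enorm) ?_
    rw [lintegral_unitCube_tsum (F := fun x => ‖H x‖ₑ) hH.enorm]
    exact hi.2.ne
  have h2 : offDiagonal H = ∑' l : d → ℤ, (if l = 0 then 0 else 1) *
      ∫⁻ x, ‖H x‖ₑ * ‖H (x + intVec l)‖ₑ := by
    refine tsum_congr fun l => ?_
    split_ifs <;> simp
  rw [h2, ← h1, ← lintegral_add_left ((measurable_periodize hH).enorm.pow_const 2),
    ← lintegral_unitCube_tsum (hH.enorm.pow_const 2)]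
  refine lintegral_mono_ae ?_
  filter_upwards [hfin] with x hx
  refine (tsum_enorm_sq_le _ hx.ne).trans (le_of_eq ?_)
  congr 1
  refine tsum_congr fun m => tsum_congr fun l => ?_
  simp only [sub_eq_zero]
  split_ifs <;> simp

variable [DecidableEq d] {H : (d → ℝ) → ℂ}

/-- Finiteness of the diagonal and off-diagonal terms puts the periodization in L² of the torus,
where Parseval applies. -/
theorem tsum_enorm_sq_integral_char (hH : Measurable H) (hi : Integrable H)
    (hT : (∫⁻ x, ‖H x‖ₑ ^ 2) ≠ ∞) (hR : offDiagonal H ≠ ∞) :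
    ∑' n, ‖∫ x, char n x * H x‖ₑ ^ 2 = ∫⁻ x in unitCube d, ‖periodize H x‖ₑ ^ 2 := by
  have hfin := (lintegral_periodize_sq_le hH).trans_lt (ENNReal.add_lt_top.2 ⟨hT.lt_top, hR.lt_top⟩)
  have hmem : MemLp (fun x : UnitAddTorus d => periodize H (torusSection x)) 2 := by
    refine ⟨((measurable_periodize hH).comp measurable_torusSection).aestronglyMeasurable, ?_⟩
    rw [eLpNorm_lt_top_iff_lintegral_rpow_enorm_lt_top (by norm_num) (by norm_num)]
    simpa [lintegral_torus_comp_section fun x => ‖periodize H x‖ₑ ^ 2] using hfin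
  simp only [← mFourierCoeff_periodize hH hi]
  rw [tsum_enorm_sq_mFourierCoeff hmem, lintegral_torus_comp_section fun x => ‖periodize H x‖ₑ ^ 2]

theorem tsum_enorm_sq_integral_char_le (hH : Measurable H) (hi : Integrable H) :
    ∑' n, ‖∫ x, char n x * H x‖ₑ ^ 2 ≤ (∫⁻ x, ‖H x‖ₑ ^ 2) + offDiagonal H := by
  by_cases hT : (∫⁻ x, ‖H x‖ₑ ^ 2) = ∞
  · simp [hT]
  by_cases hR : offDiagonal H = ∞
  · simp [hR]
  rw [tsum_enorm_sq_integral_char hH hi hT hR]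
  exact lintegral_periodize_sq_le hH

theorem lintegral_le_tsum_enorm_sq_integral_char (hH : Measurable H) (hi : Integrable H)
    (hT : (∫⁻ x, ‖H x‖ₑ ^ 2) ≠ ∞) :
    ∫⁻ x, ‖H x‖ₑ ^ 2 ≤ (∑' n, ‖∫ x, char n x * H x‖ₑ ^ 2) + offDiagonal H := by
  by_cases hR : offDiagonal H = ∞
  · simp [hR]
  rw [tsum_enorm_sq_integral_char hH hi hT hR]
  exact le_lintegral_periodize_sq hH hi

end periodization

/-! ### Affine changes of variable and the Fourier transform on L² -/

section affine

theorem act_mul (M N : Matrix (Fin 2) (Fin 2) ℝ) (x : Plane) :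
    act (M * N) x = act M (act N x) := by
  ext i
  simp [act]

theorem act_one (x : Plane) : act 1 x = x := by
  ext i
  simp [act]

theorem inner_act (M : Matrix (Fin 2) (Fin 2) ℝ) (x v : Plane) :
    inner ℝ (act M x) v = inner ℝ x (act M.transpose v) := by
  simp [act, Matrix.toLpLin_apply, PiLp.inner_apply, Fin.sum_univ_two, Matrix.transpose_apply]
  ring

theorem continuous_act (M : Matrix (Fin 2) (Fin 2) ℝ) : Continuous (act M) :=
  LinearMap.continuous_of_finiteDimensional _

variable {M : Matrix (Fin 2) (Fin 2) ℝ}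

theorem act_transpose_act_inv (hM : M.det ≠ 0) (v : Plane) :
    act M.transpose (act (M.transpose)⁻¹ v) = v := by
  rw [← act_mul, Matrix.mul_nonsing_inv _ (by simpa using hM), act_one]

theorem act_inv_act (hM : M.det ≠ 0) (v : Plane) : act M⁻¹ (act M v) = v := by
  rw [← act_mul, Matrix.nonsing_inv_mul _ (by simpa using hM), act_one]

theorem act_act_inv (hM : M.det ≠ 0) (v : Plane) : act M (act M⁻¹ v) = v := by
  rw [← act_mul, Matrix.mul_nonsing_inv _ (by simpa using hM), act_one]

/-- The affine automorphism `x ↦ M x - y` of the plane. -/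
def affineHomeo (hM : M.det ≠ 0) (y : Plane) : Plane ≃ₜ Plane where
  toFun x := act M x - y
  invFun z := act M⁻¹ (z + y)
  left_inv x := by simp only [sub_add_cancel, act_inv_act hM]
  right_inv z := by simp only [act_act_inv hM, add_sub_cancel_right]
  continuous_toFun := (continuous_act M).sub continuous_const
  continuous_invFun := (continuous_act M⁻¹).comp (continuous_id.add continuous_const)

theorem affineHomeo_apply (hM : M.det ≠ 0) (y x : Plane) : affineHomeo hM y x = act M x - y := rfl

theorem map_affineHomeo (hM : M.det ≠ 0) (y : Plane) :
    Measure.map (affineHomeo hM y) volume = ENNReal.ofReal |M.det|⁻¹ • (volume : Measure Plane) := by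
  have hdet : LinearMap.det (act M) = M.det := by
    simp [act, Matrix.toLpLin_eq_toLin]
  have h1 := Measure.map_linearMap_addHaar_eq_smul_addHaar (volume : Measure Plane)
    (f := act M) (by rwa [hdet])
  have h2 : (affineHomeo hM y : Plane → Plane) = (fun z => z - y) ∘ act M := rfl
  rw [h2, ← Measure.map_map (by fun_prop) (continuous_act M).measurable, h1,
    Measure.map_smul, (measurePreserving_sub_right volume y).map_eq, hdet, abs_inv]

theorem measurableEmbedding_affineHomeo (hM : M.det ≠ 0) (y : Plane) :
    MeasurableEmbedding (affineHomeo hM y) := (affineHomeo hM y).measurableEmbedding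

theorem quasiMeasurePreserving_affineHomeo (hM : M.det ≠ 0) (y : Plane) :
    Measure.QuasiMeasurePreserving (affineHomeo hM y) volume volume :=
  ⟨(affineHomeo hM y).continuous.measurable, by
    rw [map_affineHomeo]; exact Measure.smul_absolutelyContinuous⟩

theorem integral_comp_affineHomeo (hM : M.det ≠ 0) (y : Plane) (f : Plane → ℂ) :
    ∫ x, f (affineHomeo hM y x) = (|M.det|⁻¹ : ℝ) • ∫ x, f x := by
  rw [← (measurableEmbedding_affineHomeo hM y).integral_map, map_affineHomeo,
    integral_smul_measure, ENNReal.toReal_ofReal (by positivity)]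

theorem lintegral_comp_affineHomeo (hM : M.det ≠ 0) (y : Plane) (f : Plane → ℝ≥0∞) :
    ∫⁻ x, f (affineHomeo hM y x) = ENNReal.ofReal |M.det|⁻¹ * ∫⁻ x, f x := by
  rw [← (measurableEmbedding_affineHomeo hM y).lintegral_map, map_affineHomeo,
    lintegral_smul_measure, smul_eq_mul]

/-- Composition of a square-integrable function with `x ↦ M x - y`, multiplied by a bounded
weight. -/
theorem memLp_weight_mul_comp (hM : M.det ≠ 0) (y : Plane) {w : Plane → ℂ} (hw : Continuous w)
    (hw1 : ∀ x, ‖w x‖ ≤ 1) (ψ : L2) :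
    MemLp (fun x => w x * ψ (affineHomeo hM y x)) 2 := by
  have h : MemLp (fun x => ψ (affineHomeo hM y x)) 2 :=
    memLp_comp_act hM (memLp_comp_sub y (Lp.memLp ψ))
  refine h.of_le (hw.aestronglyMeasurable.mul h.1) (.of_forall fun x => ?_)
  rw [norm_mul]
  exact mul_le_of_le_one_left (norm_nonneg _) (hw1 x)

/-- The operator `ψ ↦ w ψ(M · - y)` of the space of square-integrable functions. -/
def weightComp (hM : M.det ≠ 0) (y : Plane) {w : Plane → ℂ} (hw : Continuous w)
    (hw1 : ∀ x, ‖w x‖ ≤ 1) (ψ : L2) : L2 := (memLp_weight_mul_comp hM y hw hw1 ψ).toLp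

theorem weightComp_coe (hM : M.det ≠ 0) (y : Plane) {w : Plane → ℂ} (hw : Continuous w)
    (hw1 : ∀ x, ‖w x‖ ≤ 1) (ψ : L2) :
    weightComp hM y hw hw1 ψ =ᵐ[volume] fun x => w x * ψ (affineHomeo hM y x) :=
  MemLp.coeFn_toLp _

/-- The Lipschitz constant is the Jacobian factor |det M|^{-1/2}. Continuity serves to extend the
Fourier identity from Schwartz functions to L². -/
theorem continuous_weightComp (hM : M.det ≠ 0) (y : Plane) {w : Plane → ℂ} (hw : Continuous w)
    (hw1 : ∀ x, ‖w x‖ ≤ 1) : Continuous (weightComp hM y hw hw1) := by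
  set c : ℝ≥0∞ := ENNReal.ofReal |M.det|⁻¹ ^ (1 / (2 : ℝ)) with hc
  have hctop : c ≠ ∞ := ENNReal.rpow_ne_top_of_nonneg (by norm_num) ENNReal.ofReal_ne_top
  refine LipschitzWith.continuous (K := c.toNNReal) fun φ ψ => ?_
  rw [ENNReal.coe_toNNReal hctop]
  unfold weightComp
  rw [Lp.edist_toLp_toLp, Lp.edist_def]
  have h1 : eLpNorm ((fun x => w x * φ (affineHomeo hM y x)) -
      fun x => w x * ψ (affineHomeo hM y x)) 2 volume
      ≤ eLpNorm ((φ - ψ : Plane → ℂ) ∘ affineHomeo hM y) 2 volume := by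
    refine eLpNorm_mono fun x => ?_
    simp only [Pi.sub_apply, Function.comp_apply, ← mul_sub, norm_mul]
    exact mul_le_of_le_one_left (norm_nonneg _) (hw1 x)
  refine h1.trans (le_of_eq ?_)
  rw [← (measurableEmbedding_affineHomeo hM y).eLpNorm_map_measure, map_affineHomeo,
    eLpNorm_smul_measure_of_ne_top (by norm_num), smul_eq_mul, hc]
  norm_num

/-- With z = M x - y and ξ = Mᵀ η one has x · ξ = z · η + y · η, so the shift comes out as a phase.
-/
theorem fourier_comp_affine (hM : M.det ≠ 0) (y : Plane) (f : Plane → ℂ) (ξ : Plane) :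
    𝓕 (fun x => f (affineHomeo hM y x)) ξ = ((|M.det|⁻¹ : ℝ) : ℂ) *
      (Complex.exp (↑(-2 * Real.pi * inner ℝ y (act (M.transpose)⁻¹ ξ)) * Complex.I) *
        𝓕 f (act (M.transpose)⁻¹ ξ)) := by
  set η := act (M.transpose)⁻¹ ξ with hη
  have hin : ∀ x, inner ℝ x ξ = inner ℝ (affineHomeo hM y x) η + inner ℝ y η := fun x => by
    rw [← inner_add_left, affineHomeo_apply, sub_add_cancel, inner_act, hη,
      act_transpose_act_inv hM]
  rw [Real.fourier_eq', Real.fourier_eq']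
  simp only [hin]
  rw [integral_comp_affineHomeo hM y fun z => Complex.exp (↑(-2 * Real.pi *
    (inner ℝ z η + inner ℝ y η)) * Complex.I) • f z, Complex.real_smul,
    ← integral_const_mul (Complex.exp _)]
  refine congrArg (fun z : ℂ => ((|M.det|⁻¹ : ℝ) : ℂ) * z)
    (integral_congr_ae (.of_forall fun z => ?_))
  simp only [smul_eq_mul]
  rw [← mul_assoc, ← Complex.exp_add]
  congr 2
  push_cast
  ring

theorem continuous_phase (N : Matrix (Fin 2) (Fin 2) ℝ) (y : Plane) :
    Continuous fun ξ : Plane =>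
      Complex.exp (↑(-2 * Real.pi * inner ℝ y (act N ξ)) * Complex.I) := by
  have := continuous_act N
  fun_prop

theorem norm_phase_le (r : ℝ) : ‖Complex.exp (↑r * Complex.I)‖ ≤ 1 :=
  (Complex.norm_exp_ofReal_mul_I r).le

theorem det_transpose_inv (hM : M.det ≠ 0) : ((M.transpose)⁻¹).det ≠ 0 := by
  rw [Matrix.det_nonsing_inv, Matrix.det_transpose, Ring.inverse_eq_inv']
  exact inv_ne_zero hM

/-- The Schwartz function `f(M · - y)`. -/
def schwartzAffine (hM : M.det ≠ 0) (y : Plane) (f : SchwartzMap Plane ℂ) :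
    SchwartzMap Plane ℂ :=
  SchwartzMap.compCLM ℂ (g := affineHomeo hM y)
    (by
      have h : (fun x => (act M).toContinuousLinearMap x - y).HasTemperateGrowth := by fun_prop
      exact h)
    (by
      set L := (act M⁻¹).toContinuousLinearMap
      refine ⟨1, ‖L‖ * (1 + ‖y‖), fun x => ?_⟩
      have hx : x = L (affineHomeo hM y x + y) := ((affineHomeo hM y).left_inv x).symm
      calc ‖x‖ = ‖L (affineHomeo hM y x + y)‖ := by rw [← hx]
        _ ≤ ‖L‖ * (‖affineHomeo hM y x‖ + ‖y‖) :=
          (L.le_opNorm _).trans (mul_le_mul_of_nonneg_left (norm_add_le _ _) (norm_nonneg _))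
        _ ≤ ‖L‖ * (1 + ‖y‖) * (1 + ‖affineHomeo hM y x‖) ^ 1 := by
          rw [pow_one, mul_assoc]
          refine mul_le_mul_of_nonneg_left ?_ (norm_nonneg _)
          nlinarith [norm_nonneg y, norm_nonneg (affineHomeo hM y x)]) f

theorem schwartzAffine_apply (hM : M.det ≠ 0) (y : Plane) (f : SchwartzMap Plane ℂ) :
    (schwartzAffine hM y f : Plane → ℂ) = fun x => f (affineHomeo hM y x) := rfl

/-- The Fourier transform of `ψ(M · - y)` for square-integrable `ψ`. -/
theorem fourier_weightComp_one (hM : M.det ≠ 0) (y : Plane) (ψ : L2) :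
    𝓕 (weightComp hM y (w := fun _ => 1) continuous_const (by simp) ψ) =
      ((|M.det|⁻¹ : ℝ) : ℂ) • weightComp (det_transpose_inv hM) 0
        (continuous_phase (M.transpose)⁻¹ y) (fun _ => norm_phase_le _) (𝓕 ψ : L2) := by
  have hF : Continuous (fun ψ : L2 => (𝓕 ψ : L2)) := (Lp.fourierTransformₗᵢ Plane ℂ).continuous
  have hV : Continuous fun ψ : L2 => ((|M.det|⁻¹ : ℝ) : ℂ) • weightComp (det_transpose_inv hM) 0
      (continuous_phase (M.transpose)⁻¹ y) (fun _ => norm_phase_le _) (𝓕 ψ : L2) := by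
    have := (continuous_weightComp (det_transpose_inv hM) 0
      (continuous_phase (M.transpose)⁻¹ y) (fun _ => norm_phase_le _)).comp hF
    exact this.const_smul (((|M.det|⁻¹ : ℝ) : ℂ))
  -- Both sides are continuous in ψ, so Schwartz functions suffice; for them the transform is given
  -- by the integral.
  refine DenseRange.induction_on
    (SchwartzMap.denseRange_toLpCLM (E := Plane) (F := ℂ) (p := 2) (μ := volume)
      ENNReal.ofNat_ne_top) ψ
    (isClosed_eq (hF.comp (continuous_weightComp _ _ _ _)) hV) fun f => ?_
  have h1 : weightComp hM y (w := fun _ => 1) continuous_const (by simp)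
      (SchwartzMap.toLpCLM ℝ ℂ 2 volume f) = (schwartzAffine hM y f).toLp 2 := by
    refine Lp.ext ?_
    filter_upwards [weightComp_coe hM y (w := fun _ => 1) continuous_const (by simp)
      (SchwartzMap.toLpCLM ℝ ℂ 2 volume f), (schwartzAffine hM y f).coeFn_toLp 2 volume,
      (quasiMeasurePreserving_affineHomeo hM y).ae (f.coeFn_toLp 2 volume)] with x hx1 hx2 hx3
    rw [hx1, hx2, one_mul, schwartzAffine_apply]
    exact hx3
  rw [h1, SchwartzMap.toLp_fourier_eq, SchwartzMap.toLpCLM_apply, SchwartzMap.toLp_fourier_eq]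
  refine Lp.ext ?_
  filter_upwards [(𝓕 (schwartzAffine hM y f)).coeFn_toLp 2 volume,
    Lp.coeFn_smul ((|M.det|⁻¹ : ℝ) : ℂ) (weightComp (det_transpose_inv hM) 0
        (continuous_phase (M.transpose)⁻¹ y) (fun _ => norm_phase_le _) ((𝓕 f).toLp 2)),
    weightComp_coe (det_transpose_inv hM) 0 (continuous_phase (M.transpose)⁻¹ y)
      (fun _ => norm_phase_le _) ((𝓕 f).toLp 2),
    (quasiMeasurePreserving_affineHomeo (det_transpose_inv hM) 0).ae
      ((𝓕 f).coeFn_toLp 2 volume)] with ξ h2 h3 h4 h5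
  rw [h2, h3, Pi.smul_apply, h4, h5, smul_eq_mul, SchwartzMap.fourier_coe, schwartzAffine_apply,
    fourier_comp_affine, affineHomeo_apply, sub_zero, SchwartzMap.fourier_coe]

end affine

/-! ### Packet coefficients as Fourier coefficients over the dual lattice -/

section fibers

theorem measurableEmbedding_toLp :
    MeasurableEmbedding (WithLp.toLp 2 : (Fin 2 → ℝ) → Plane) :=
  (MeasurableEquiv.toLp 2 (Fin 2 → ℝ)).measurableEmbedding

theorem act_eq_affineHomeo {Q : Matrix (Fin 2) (Fin 2) ℝ} (hQ : Q.det ≠ 0) (x : Plane) :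
    act Q x = affineHomeo hQ 0 x := by rw [affineHomeo_apply, sub_zero]

theorem lintegral_act_toLp {Q : Matrix (Fin 2) (Fin 2) ℝ} (hQ : Q.det ≠ 0) (F : Plane → ℝ≥0∞) :
    ∫⁻ u : Fin 2 → ℝ, F (act Q (WithLp.toLp 2 u)) = ENNReal.ofReal |Q.det|⁻¹ * ∫⁻ ξ, F ξ := by
  rw [(PiLp.volume_preserving_toLp (Fin 2)).lintegral_comp_emb measurableEmbedding_toLp
    fun x => F (act Q x)]
  simp only [act_eq_affineHomeo hQ]
  rw [lintegral_comp_affineHomeo]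

theorem integral_act_toLp {Q : Matrix (Fin 2) (Fin 2) ℝ} (hQ : Q.det ≠ 0) (F : Plane → ℂ) :
    ∫ u : Fin 2 → ℝ, F (act Q (WithLp.toLp 2 u)) = ((|Q.det|⁻¹ : ℝ) : ℂ) * ∫ ξ, F ξ := by
  rw [(PiLp.volume_preserving_toLp (Fin 2)).integral_comp measurableEmbedding_toLp
    fun x => F (act Q x)]
  simp only [act_eq_affineHomeo hQ]
  rw [integral_comp_affineHomeo, Complex.real_smul]

theorem quasiMeasurePreserving_act_toLp {Q : Matrix (Fin 2) (Fin 2) ℝ} (hQ : Q.det ≠ 0) :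
    Measure.QuasiMeasurePreserving (fun u : Fin 2 → ℝ => act Q (WithLp.toLp 2 u))
      volume volume := by
  have e : (fun u : Fin 2 → ℝ => act Q (WithLp.toLp 2 u)) =
      affineHomeo hQ 0 ∘ (WithLp.toLp 2 : (Fin 2 → ℝ) → Plane) :=
    funext fun u => act_eq_affineHomeo hQ _
  rw [e]
  exact (quasiMeasurePreserving_affineHomeo hQ 0).comp
    (PiLp.volume_preserving_toLp (Fin 2)).quasiMeasurePreserving

theorem memLp_act_toLp {Q : Matrix (Fin 2) (Fin 2) ℝ} (hQ : Q.det ≠ 0) (f : L2) :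
    MemLp (fun u : Fin 2 → ℝ => f (act Q (WithLp.toLp 2 u))) 2 :=
  (memLp_comp_act hQ (Lp.memLp f)).comp_measurePreserving (PiLp.volume_preserving_toLp (Fin 2))

theorem char_eq_exp (n : Fin 2 → ℤ) (u : Fin 2 → ℝ) :
    char n u = Complex.exp (↑(-2 * Real.pi *
      inner ℝ (WithLp.toLp 2 (intVec n) : Plane) (WithLp.toLp 2 u)) * Complex.I) := by
  simp only [char, UnitAddTorus.mFourier, ContinuousMap.coe_mk, Fin.prod_univ_two,
    fourier_coe_apply, PiLp.inner_apply, Fin.sum_univ_two, intVec, ← Complex.exp_add]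
  congr 1
  simp
  ring

variable {M P : Matrix (Fin 2) (Fin 2) ℝ}

/-- The matrix `Mᵀ P⁻ᵀ`, which maps `ℤ²` onto the frequency shifts of the packets `φ(M · - y)`,
`y ∈ P ℤ²`. -/
def freqMatrix (M P : Matrix (Fin 2) (Fin 2) ℝ) : Matrix (Fin 2) (Fin 2) ℝ :=
  M.transpose * (P.transpose)⁻¹

theorem det_freqMatrix : (freqMatrix M P).det = M.det / P.det := by
  rw [freqMatrix, Matrix.det_mul, Matrix.det_nonsing_inv, Matrix.det_transpose,
    Matrix.det_transpose, Ring.inverse_eq_inv', div_eq_mul_inv]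

theorem det_freqMatrix_ne (hM : M.det ≠ 0) (hP : P.det ≠ 0) : (freqMatrix M P).det ≠ 0 := by
  rw [det_freqMatrix]; exact div_ne_zero hM hP

theorem act_inv_freqMatrix (hM : M.det ≠ 0) (x : Plane) :
    act (M.transpose)⁻¹ (act (freqMatrix M P) x) = act (P.transpose)⁻¹ x := by
  rw [freqMatrix, ← act_mul, ← mul_assoc, Matrix.nonsing_inv_mul _ (by simpa using hM), one_mul]

/-- The product of the conjugate of `g` with the window `ψ`, in frequency coordinates adapted to
the dual lattice. -/
def fiber (M P : Matrix (Fin 2) (Fin 2) ℝ) (g ψ : L2) (u : Fin 2 → ℝ) : ℂ :=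
  starRingEnd ℂ (g (act (freqMatrix M P) (WithLp.toLp 2 u))) *
    ψ (act (P.transpose)⁻¹ (WithLp.toLp 2 u))

theorem measurable_Lp_act_toLp (Q : Matrix (Fin 2) (Fin 2) ℝ) (f : L2) :
    Measurable fun u : Fin 2 → ℝ => f (act Q (WithLp.toLp 2 u)) :=
  (Lp.stronglyMeasurable f).measurable.comp
    ((continuous_act Q).measurable.comp measurableEmbedding_toLp.measurable)

theorem measurable_fiber (g ψ : L2) : Measurable (fiber M P g ψ) :=
  (Complex.continuous_conj.measurable.comp (measurable_Lp_act_toLp _ g)).mul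
    (measurable_Lp_act_toLp _ ψ)

theorem integrable_fiber (hM : M.det ≠ 0) (hP : P.det ≠ 0) (g ψ : L2) :
    Integrable (fiber M P g ψ) :=
  MemLp.integrable_mul (p := 2) (q := 2) (memLp_act_toLp (det_freqMatrix_ne hM hP) g).star
    (memLp_act_toLp (det_transpose_inv hP) ψ)

theorem enorm_fiber (hM : M.det ≠ 0) (g ψ : L2) (u : Fin 2 → ℝ) :
    ‖fiber M P g ψ u‖ₑ = ‖g (act (freqMatrix M P) (WithLp.toLp 2 u))‖ₑ *
      ‖ψ (act (M.transpose)⁻¹ (act (freqMatrix M P) (WithLp.toLp 2 u)))‖ₑ := by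
  rw [fiber, enorm_mul, RCLike.enorm_conj, act_inv_freqMatrix hM]

theorem lintegral_fiber_sq (hM : M.det ≠ 0) (hP : P.det ≠ 0) (g ψ : L2) :
    ∫⁻ u, ‖fiber M P g ψ u‖ₑ ^ 2 = ENNReal.ofReal (|P.det| / |M.det|) *
      ∫⁻ ξ, ‖g ξ‖ₑ ^ 2 * ‖ψ (act (M.transpose)⁻¹ ξ)‖ₑ ^ 2 := by
  simp only [enorm_fiber hM, mul_pow]
  rw [lintegral_act_toLp (det_freqMatrix_ne hM hP)
    fun ξ => ‖g ξ‖ₑ ^ 2 * ‖ψ (act (M.transpose)⁻¹ ξ)‖ₑ ^ 2, det_freqMatrix, abs_div, inv_div]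

/-- The packet `x ↦ ψ (M x - y)`. -/
def affinePacket (hM : M.det ≠ 0) (φ : L2) (y : Plane) : L2 :=
  weightComp hM y (w := fun _ => 1) continuous_const (by simp) φ

/-- Plancherel produces the phase y · M⁻ᵀ ξ. For y = P n and ξ = Mᵀ P⁻ᵀ u it equals n · u, so the
phase becomes the character of index n; the Jacobian |det M / det P| cancels |det M|⁻¹ and leaves
|det P|⁻¹. -/
theorem inner_affinePacket (hM : M.det ≠ 0) (hP : P.det ≠ 0) (f φ : L2) (n : Fin 2 → ℤ) :
    inner ℂ f (affinePacket hM φ (act P (WithLp.toLp 2 (intVec n)))) =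
      ((|P.det|⁻¹ : ℝ) : ℂ) * ∫ u, char n u * fiber M P (𝓕 f : L2) (𝓕 φ : L2) u := by
  set y := act P (WithLp.toLp 2 (intVec n)) with hy
  have hMa : |M.det| ≠ 0 := abs_ne_zero.2 hM
  have h1 : inner ℂ f (affinePacket hM φ y) = ((|M.det|⁻¹ : ℝ) : ℂ) *
      ∫ ξ, Complex.exp (↑(-2 * Real.pi * inner ℝ y (act (M.transpose)⁻¹ ξ)) * Complex.I) *
        (starRingEnd ℂ ((𝓕 f : L2) ξ) * (𝓕 φ : L2) (act (M.transpose)⁻¹ ξ)) := by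
    rw [← Lp.inner_fourier_eq, affinePacket, fourier_weightComp_one, inner_smul_right,
      L2.inner_def]
    congr 1
    refine integral_congr_ae ?_
    filter_upwards [weightComp_coe (det_transpose_inv hM) 0
      (continuous_phase (M.transpose)⁻¹ y) (fun _ => norm_phase_le _) (𝓕 φ : L2)] with ξ hξ
    rw [hξ, affineHomeo_apply, sub_zero, RCLike.inner_apply]
    ring
  have h2 := integral_act_toLp (det_freqMatrix_ne hM hP) fun ξ =>
    Complex.exp (↑(-2 * Real.pi * inner ℝ y (act (M.transpose)⁻¹ ξ)) * Complex.I) *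
        (starRingEnd ℂ ((𝓕 f : L2) ξ) * (𝓕 φ : L2) (act (M.transpose)⁻¹ ξ))
  have h3 : ∀ u : Fin 2 → ℝ, inner ℝ y (act (P.transpose)⁻¹ (WithLp.toLp 2 u)) =
      inner ℝ (WithLp.toLp 2 (intVec n) : Plane) (WithLp.toLp 2 u) := fun u => by
    rw [hy, inner_act, act_transpose_act_inv hP]
  simp only [act_inv_freqMatrix hM, h3, ← char_eq_exp] at h2
  rw [h1]
  unfold fiber
  rw [h2, det_freqMatrix, ← mul_assoc]
  congr 1
  rw [← Complex.ofReal_mul, abs_div]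
  congr 1
  have hPa : |P.det| ≠ 0 := abs_ne_zero.2 hP
  field_simp

theorem enorm_inner_affinePacket_sq (hM : M.det ≠ 0) (hP : P.det ≠ 0) (f φ : L2) (c : ℝ)
    (hc : c ^ 2 = |M.det|) (n : Fin 2 → ℤ) :
    ‖inner ℂ f ((c : ℂ) • affinePacket hM φ (act P (WithLp.toLp 2 (intVec n))))‖ₑ ^ 2 =
      ENNReal.ofReal (|M.det| / |P.det| ^ 2) *
        ‖∫ u, char n u * fiber M P (𝓕 f : L2) (𝓕 φ : L2) u‖ₑ ^ 2 := by
  have e : ∀ r : ℝ, ‖(r : ℂ)‖ₑ ^ 2 = ENNReal.ofReal (r ^ 2) := fun r => by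
    rw [← ofReal_norm, ← ENNReal.ofReal_pow (norm_nonneg _), Complex.norm_real, Real.norm_eq_abs,
      sq_abs]
  rw [inner_smul_right, inner_affinePacket hM hP, enorm_mul, enorm_mul, mul_pow, mul_pow, e, e,
    ← mul_assoc, ← ENNReal.ofReal_mul (sq_nonneg c), hc, inv_pow, div_eq_mul_inv]

/-- The frequency-side energy `∫ |f^|² |φ^(M⁻ᵀ ·)|²`. -/
def energy (M : Matrix (Fin 2) (Fin 2) ℝ) (f φ : L2) : ℝ≥0∞ :=
  ∫⁻ ξ, ‖(𝓕 f : L2) ξ‖ₑ ^ 2 * ‖(𝓕 φ : L2) (act (M.transpose)⁻¹ ξ)‖ₑ ^ 2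

theorem ofReal_mul_ofReal_div (hM : M.det ≠ 0) (hP : P.det ≠ 0) :
    ENNReal.ofReal (|M.det| / |P.det| ^ 2) * ENNReal.ofReal (|P.det| / |M.det|) =
      ENNReal.ofReal |P.det|⁻¹ := by
  rw [← ENNReal.ofReal_mul (by positivity)]
  congr 1
  have hMa : |M.det| ≠ 0 := abs_ne_zero.2 hM
  have hPa : |P.det| ≠ 0 := abs_ne_zero.2 hP
  field_simp

theorem tsum_enorm_inner_affinePacket_le (hM : M.det ≠ 0) (hP : P.det ≠ 0) (f φ : L2) (c : ℝ)
    (hc : c ^ 2 = |M.det|) :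
    ∑' n, ‖inner ℂ f ((c : ℂ) • affinePacket hM φ (act P (WithLp.toLp 2 (intVec n))))‖ₑ ^ 2 ≤
      ENNReal.ofReal |P.det|⁻¹ * energy M f φ + ENNReal.ofReal (|M.det| / |P.det| ^ 2) *
        offDiagonal (fiber M P (𝓕 f : L2) (𝓕 φ : L2)) := by
  simp only [enorm_inner_affinePacket_sq hM hP f φ c hc]
  rw [ENNReal.tsum_mul_left, ← ofReal_mul_ofReal_div hM hP, mul_assoc, energy,
    ← lintegral_fiber_sq hM hP, ← mul_add]
  gcongr
  exact tsum_enorm_sq_integral_char_le (measurable_fiber _ _) (integrable_fiber hM hP _ _)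

theorem energy_le_tsum_enorm_inner_affinePacket (hM : M.det ≠ 0) (hP : P.det ≠ 0) (f φ : L2)
    (c : ℝ) (hc : c ^ 2 = |M.det|) (hE : energy M f φ ≠ ∞) :
    ENNReal.ofReal |P.det|⁻¹ * energy M f φ ≤
      (∑' n, ‖inner ℂ f ((c : ℂ) •
        affinePacket hM φ (act P (WithLp.toLp 2 (intVec n))))‖ₑ ^ 2) +
      ENNReal.ofReal (|M.det| / |P.det| ^ 2) *
        offDiagonal (fiber M P (𝓕 f : L2) (𝓕 φ : L2)) := by
  simp only [enorm_inner_affinePacket_sq hM hP f φ c hc]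
  rw [ENNReal.tsum_mul_left, ← ofReal_mul_ofReal_div hM hP, mul_assoc, energy,
    ← lintegral_fiber_sq hM hP, ← mul_add]
  gcongr
  refine lintegral_le_tsum_enorm_sq_integral_char (measurable_fiber _ _)
    (integrable_fiber hM hP _ _) ?_
  rw [lintegral_fiber_sq hM hP]
  exact ENNReal.mul_ne_top ENNReal.ofReal_ne_top hE

/-- The larger of a and b is squared and keeps its own bound. This separates the values of f^ at two
frequencies, and is why the window products must be controlled by an envelope at both points. -/
theorem mul_mul_le_of_le {a b s p q : ℝ≥0∞} (hp : s ≤ p) (hq : s ≤ q) :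
    a * b * s ≤ a ^ 2 * p + b ^ 2 * q := by
  rcases le_total a b with h | h
  · calc a * b * s ≤ b * b * q := by gcongr
      _ ≤ _ := by rw [← sq]; exact le_add_self
  · calc a * b * s ≤ a * a * p := by gcongr
      _ ≤ _ := by rw [← sq]; exact le_self_add

/-- Each cross term is split into |f^|² v at the two points. By translation invariance both have the
same integral, whence the factor 2. -/
theorem offDiagonal_fiber_le (hM : M.det ≠ 0) (hP : P.det ≠ 0) (f φ : L2)
    {v : Plane → ℝ≥0∞} (hv : Measurable v) (w : (Fin 2 → ℤ) → ℝ≥0∞)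
    (hw : ∀ l : Fin 2 → ℤ, l ≠ 0 → ∀ᵐ η : Plane,
      ‖(𝓕 φ : L2) η‖ₑ * ‖(𝓕 φ : L2) (η + act (P.transpose)⁻¹ (WithLp.toLp 2 (intVec l)))‖ₑ ≤
        w l * v η ∧
      ‖(𝓕 φ : L2) η‖ₑ * ‖(𝓕 φ : L2) (η + act (P.transpose)⁻¹ (WithLp.toLp 2 (intVec l)))‖ₑ ≤
        w l * v (η + act (P.transpose)⁻¹ (WithLp.toLp 2 (intVec l)))) :
    ENNReal.ofReal (|M.det| / |P.det| ^ 2) * offDiagonal (fiber M P (𝓕 f : L2) (𝓕 φ : L2)) ≤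
      ENNReal.ofReal |P.det|⁻¹ * ((2 * ∑' l, if l = 0 then 0 else w l) *
        ∫⁻ ξ, ‖(𝓕 f : L2) ξ‖ₑ ^ 2 * v (act (M.transpose)⁻¹ ξ)) := by
  set G : (Fin 2 → ℝ) → ℝ≥0∞ := fun u =>
    ‖(𝓕 f : L2) (act (freqMatrix M P) (WithLp.toLp 2 u))‖ₑ ^ 2 *
      v (act (P.transpose)⁻¹ (WithLp.toLp 2 u)) with hG
  have hGm : Measurable G := ((measurable_Lp_act_toLp _ _).enorm.pow_const 2).mul
    (hv.comp ((continuous_act _).measurable.comp measurableEmbedding_toLp.measurable))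
  have hGint : ∫⁻ u, G u = ENNReal.ofReal (|P.det| / |M.det|) *
      ∫⁻ ξ, ‖(𝓕 f : L2) ξ‖ₑ ^ 2 * v (act (M.transpose)⁻¹ ξ) := by
    simp only [hG, ← act_inv_freqMatrix (P := P) hM]
    rw [lintegral_act_toLp (det_freqMatrix_ne hM hP)
      fun ξ => ‖(𝓕 f : L2) ξ‖ₑ ^ 2 * v (act (M.transpose)⁻¹ ξ), det_freqMatrix, abs_div, inv_div]
  have key : ∀ l : Fin 2 → ℤ, l ≠ 0 → ∫⁻ u, ‖fiber M P (𝓕 f : L2) (𝓕 φ : L2) u‖ₑ *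
      ‖fiber M P (𝓕 f : L2) (𝓕 φ : L2) (u + intVec l)‖ₑ ≤ 2 * w l * ∫⁻ u, G u := by
    intro l hl
    calc ∫⁻ u, ‖fiber M P (𝓕 f : L2) (𝓕 φ : L2) u‖ₑ *
          ‖fiber M P (𝓕 f : L2) (𝓕 φ : L2) (u + intVec l)‖ₑ
        ≤ ∫⁻ u, w l * (G u + G (u + intVec l)) := by
          refine lintegral_mono_ae ?_
          filter_upwards [(quasiMeasurePreserving_act_toLp (det_transpose_inv hP)).ae (hw l hl)]
            with u hu
          have e : act (P.transpose)⁻¹ (WithLp.toLp 2 (u + intVec l)) =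
              act (P.transpose)⁻¹ (WithLp.toLp 2 u) +
                act (P.transpose)⁻¹ (WithLp.toLp 2 (intVec l)) := by
            rw [WithLp.toLp_add, map_add]
          rw [fiber, fiber, enorm_mul, enorm_mul, RCLike.enorm_conj, RCLike.enorm_conj,
            mul_mul_mul_comm, e]
          refine (mul_mul_le_of_le hu.1 hu.2).trans (le_of_eq ?_)
          simp only [hG, e]
          ring
      _ = 2 * w l * ∫⁻ u, G u := by
          have hs : Measurable fun u => G u + G (u + intVec l) :=
            hGm.add (hGm.comp (measurable_id.add_const (intVec l)))
          rw [lintegral_const_mul _ hs,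
            lintegral_add_left hGm, lintegral_add_right_eq_self]
          ring
  calc _ ≤ ENNReal.ofReal (|M.det| / |P.det| ^ 2) *
        ∑' l : Fin 2 → ℤ, 2 * (if l = 0 then 0 else w l) * ∫⁻ u, G u := by
        gcongr
        refine ENNReal.tsum_le_tsum fun l => ?_
        split_ifs with hl
        · simp
        · exact key l hl
    _ = _ := by
        rw [ENNReal.tsum_mul_right, ENNReal.tsum_mul_left, hGint,
          ← ofReal_mul_ofReal_div hM hP]
        ring

end fibers

/-! ### Uniform summability of the envelopes over scales and angles -/

section counting

/-- A bound, uniform in `x`, for the sums of `1 / (1 + (k - x) ^ 2)` over integers `k`. -/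
def cauchyConst : ℝ := 3 * ∑' n : ℤ, 1 / (1 + (n : ℝ) ^ 2)

theorem summable_one_div_one_add_sq : Summable fun n : ℤ => 1 / (1 + (n : ℝ) ^ 2) := by
  refine Summable.of_norm_bounded_eventually
    (Real.summable_one_div_int_pow (p := 2).2 (by norm_num)) ?_
  refine (Set.finite_singleton (0 : ℤ)).subset fun n hn => ?_
  by_contra h0
  refine hn ?_
  have : (n : ℝ) ≠ 0 := by exact_mod_cast h0
  have h2 : 0 < (n : ℝ) ^ 2 := by positivity
  change ‖1 / (1 + (n : ℝ) ^ 2)‖ ≤ 1 / (n : ℝ) ^ 2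
  rw [Real.norm_of_nonneg (by positivity)]
  exact one_div_le_one_div_of_le h2 (by linarith)

theorem cauchyConst_pos : 0 < cauchyConst := by
  refine mul_pos (by norm_num) (summable_one_div_one_add_sq.tsum_pos (fun n => by positivity) 0 ?_)
  norm_num

theorem sum_one_div_one_add_sq_le (s : Finset ℤ) (x : ℝ) :
    ∑ k ∈ s, 1 / (1 + ((k : ℝ) - x) ^ 2) ≤ cauchyConst := by
  -- Moving x to ⌊x⌋ shifts by at most 1, and (u + v)² ≤ 2 u² + 2 for |v| ≤ 1; this is where 3 comes
  -- from.
  have h : ∀ k : ℤ, 1 / (1 + ((k : ℝ) - x) ^ 2) ≤ 3 * (1 / (1 + ((k - ⌊x⌋ : ℤ) : ℝ) ^ 2)) := by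
    intro k
    have h1 := Int.floor_le x
    have h2 := Int.lt_floor_add_one x
    rw [← mul_div_assoc, mul_one, div_le_div_iff₀ (by positivity) (by positivity)]
    push_cast
    have h3 : (x - ⌊x⌋) ^ 2 ≤ 1 := by nlinarith
    nlinarith [sq_nonneg (((k : ℝ) - x) - (x - ⌊x⌋))]
  have hs : Summable fun k : ℤ => 1 / (1 + ((k - ⌊x⌋ : ℤ) : ℝ) ^ 2) :=
    (Equiv.subRight ⌊x⌋).summable_iff.2 summable_one_div_one_add_sq
  calc _ ≤ ∑ k ∈ s, 3 * (1 / (1 + ((k - ⌊x⌋ : ℤ) : ℝ) ^ 2)) := Finset.sum_le_sum fun k _ => h k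
    _ = 3 * ∑ k ∈ s, (1 / (1 + ((k - ⌊x⌋ : ℤ) : ℝ) ^ 2)) := by rw [Finset.mul_sum]
    _ ≤ 3 * ∑' k : ℤ, (1 / (1 + ((k - ⌊x⌋ : ℤ) : ℝ) ^ 2)) := by
      gcongr
      exact hs.sum_le_tsum _ fun k _ => by positivity
    _ = _ := by
      rw [cauchyConst, ← (Equiv.subRight ⌊x⌋).tsum_eq fun n : ℤ => 1 / (1 + (n : ℝ) ^ 2)]
      rfl

theorem sum_nat_one_div_one_add_sq_le (s : Finset ℕ) (x : ℝ) :
    ∑ k ∈ s, 1 / (1 + ((k : ℝ) - x) ^ 2) ≤ cauchyConst := by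
  have := sum_one_div_one_add_sq_le (s.map Nat.castEmbedding) x
  simpa using this

/-- Jordan's inequality |sin (π t)| ≥ 2 |t| for |t| ≤ 1/2, with t the signed distance from y to the
nearest integer. -/
theorem four_mul_sq_sub_round_le_sin_sq (y : ℝ) :
    4 * (y - round y) ^ 2 ≤ Real.sin (Real.pi * y) ^ 2 := by
  have h1 : |Real.pi * (y - round y)| ≤ Real.pi / 2 := by
    rw [abs_mul, abs_of_pos Real.pi_pos]
    nlinarith [abs_sub_round y, Real.pi_pos]
  have h2 := Real.mul_abs_le_abs_sin h1
  have h3 : |Real.sin (Real.pi * (y - round y))| = |Real.sin (Real.pi * y)| := by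
    rw [mul_sub, mul_comm Real.pi (round y : ℝ), Real.sin_sub_int_mul_pi, abs_mul]
    simp
  rw [h3, abs_mul, abs_of_pos Real.pi_pos, ← mul_assoc, div_mul_cancel₀ _ Real.pi_ne_zero] at h2
  have h4 := pow_le_pow_left₀ (by positivity) h2 2
  rw [mul_pow, sq_abs, sq_abs] at h4
  linarith

/-- The angle is π y with y = β / π + 2 k / N. As k varies, y stays in a half-open interval of
length 2, so its nearest integer takes at most four values. For a fixed nearest integer n, N (y - n)
/ 2 is k minus a constant, and the sine sum is dominated by a shifted Cauchy sum. -/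
theorem sum_one_div_one_add_sin_sq_le {N : ℕ} (hN : N ≠ 0) (β : ℝ) :
    ∑ k ∈ Finset.range N,
      1 / (1 + (N : ℝ) ^ 2 * Real.sin (β + 2 * k * Real.pi / N) ^ 2) ≤ 4 * cauchyConst := by
  set m := ⌊β / Real.pi⌋ with hm
  have hN0 : (0 : ℝ) < N := by positivity
  set c : ℤ → ℝ := fun n => n * N / 2 - N * (β / Real.pi) / 2 with hc
  have h : ∀ k ∈ Finset.range N,
      1 / (1 + (N : ℝ) ^ 2 * Real.sin (β + 2 * k * Real.pi / N) ^ 2) ≤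
        ∑ i ∈ Finset.range 4, 1 / (1 + ((k : ℝ) - c (m + i)) ^ 2) := by
    intro k hk
    rw [Finset.mem_range] at hk
    have hk' : (k : ℝ) < N := by exact_mod_cast hk
    set y : ℝ := β / Real.pi + 2 * k / N with hy
    have hyβ : β + 2 * k * Real.pi / N = Real.pi * y := by
      rw [hy]; field_simp
    have hk0 : 0 ≤ 2 * (k : ℝ) / N := by positivity
    have hk2 : 2 * (k : ℝ) / N < 2 := by rw [div_lt_iff₀ hN0]; linarith
    have hlow : m ≤ round y := by
      rw [round_eq, hm]
      exact Int.floor_le_floor (by linarith)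
    have hup : round y < m + 4 := by
      rw [round_eq, Int.floor_lt]
      push_cast
      have := Int.lt_floor_add_one (β / Real.pi)
      linarith
    obtain ⟨i, hi⟩ := Int.eq_ofNat_of_zero_le (sub_nonneg.2 hlow)
    have hi4 : i < 4 := by omega
    have hri : round y = m + i := by omega
    have h1 : 1 / (1 + (N : ℝ) ^ 2 * Real.sin (β + 2 * k * Real.pi / N) ^ 2) ≤
        1 / (1 + ((k : ℝ) - c (m + i)) ^ 2) := by
      refine one_div_le_one_div_of_le (by positivity) ?_
      have h2 := four_mul_sq_sub_round_le_sin_sq y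
      rw [hri] at h2
      have h3 : ((k : ℝ) - c (m + i)) = N / 2 * (y - ((m + i : ℤ) : ℝ)) := by
        simp only [hc, hy]; field_simp; ring
      rw [h3, hyβ]
      nlinarith [mul_le_mul_of_nonneg_left h2 (sq_nonneg (N : ℝ)),
        sq_nonneg ((N : ℝ) * (y - ((m + i : ℤ) : ℝ)))]
    refine h1.trans (Finset.single_le_sum (f := fun i : ℕ => 1 / (1 + ((k : ℝ) - c (m + i)) ^ 2))
      (fun i _ => by positivity) (Finset.mem_range.2 hi4))
  refine (Finset.sum_le_sum h).trans ?_
  rw [Finset.sum_comm]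
  refine (Finset.sum_le_sum fun (i : ℕ) _ =>
    sum_nat_one_div_one_add_sq_le (Finset.range N) (c (m + i))).trans ?_
  simp

/-- A bound, uniform in `r`, for the sums of `min 1 (t ^ ς) / t ^ 2` over `t = r / 4 ^ j`. -/
def scaleConst (ς : ℝ) : ℝ := (1 + 2 / (min 2 (ς - 2) * Real.log 4) ^ 2) * cauchyConst

/-- For t ≥ 1 the quotient is at most t⁻², for t ≤ 1 at most t^{ς - 2}. When ς > 2 it therefore
decays geometrically in both directions of scale. -/
theorem min_one_rpow_div_sq_le {ς t : ℝ} (ht : 0 < t) :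
    min 1 (t ^ ς) / t ^ 2 ≤ Real.exp (-(min 2 (ς - 2) * |Real.log t|)) := by
  set q := min 2 (ς - 2) with hq
  have e1 : t ^ ς / t ^ 2 = Real.exp ((ς - 2) * Real.log t) := by
    rw [← Real.rpow_natCast, ← Real.rpow_sub ht, Real.rpow_def_of_pos ht, mul_comm]
    norm_num
  have e2 : 1 / t ^ 2 = Real.exp (-2 * Real.log t) := by
    rw [← Real.rpow_natCast, one_div, ← Real.rpow_neg ht.le, Real.rpow_def_of_pos ht, mul_comm]
    norm_num
  rcases le_total 0 (Real.log t) with h | h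
  · calc min 1 (t ^ ς) / t ^ 2 ≤ 1 / t ^ 2 := by gcongr; exact min_le_left _ _
      _ ≤ _ := by
        rw [e2, abs_of_nonneg h]
        refine Real.exp_le_exp.2 ?_
        nlinarith [min_le_left 2 (ς - 2)]
  · calc min 1 (t ^ ς) / t ^ 2 ≤ t ^ ς / t ^ 2 := by gcongr; exact min_le_right _ _
      _ ≤ _ := by
        rw [e1, abs_of_nonpos h]
        refine Real.exp_le_exp.2 ?_
        nlinarith [min_le_right 2 (ς - 2)]

theorem exp_neg_mul_abs_le {a : ℝ} (ha : 0 < a) (y : ℝ) :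
    Real.exp (-(a * |y|)) ≤ (1 + 2 / a ^ 2) * (1 / (1 + y ^ 2)) := by
  have h := Real.quadratic_le_exp_of_nonneg (x := a * |y|) (by positivity)
  rw [mul_pow, sq_abs] at h
  rw [Real.exp_neg, mul_one_div, inv_eq_one_div, div_le_div_iff₀ (Real.exp_pos _) (by positivity),
    one_mul]
  have h1 : 1 ≤ Real.exp (a * |y|) := Real.one_le_exp (by positivity)
  have h2 : y ^ 2 ≤ 2 / a ^ 2 * Real.exp (a * |y|) := by
    rw [div_mul_eq_mul_div, le_div_iff₀ (by positivity)]
    have : 0 ≤ a * |y| := by positivity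
    nlinarith
  linarith

/-- In logarithmic scale the points r / 4 ^ j are equally spaced, centred at j = log r / log 4. The
exponential decay is weakened to a Cauchy weight so that the same uniform sum bound applies. -/
theorem sum_min_one_rpow_div_sq_le {ς : ℝ} (hς : 2 < ς) {r : ℝ} (hr : 0 < r) (s : Finset ℕ) :
    ∑ j ∈ s, min 1 ((r / 4 ^ j) ^ ς) / (r / 4 ^ j) ^ 2 ≤ scaleConst ς := by
  have hq : 0 < min 2 (ς - 2) := lt_min (by norm_num) (by linarith)
  have h4 : 0 < Real.log 4 := Real.log_pos (by norm_num)
  have h : ∀ j ∈ s, min 1 ((r / 4 ^ j) ^ ς) / (r / 4 ^ j) ^ 2 ≤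
      (1 + 2 / (min 2 (ς - 2) * Real.log 4) ^ 2) *
        (1 / (1 + ((j : ℝ) - Real.log r / Real.log 4) ^ 2)) := by
    intro j _
    refine (min_one_rpow_div_sq_le (by positivity)).trans ?_
    refine le_trans (le_of_eq ?_) (exp_neg_mul_abs_le (mul_pos hq h4) _)
    rw [mul_assoc]
    congr 3
    rw [← abs_of_pos h4, ← abs_mul, abs_of_pos h4, Real.log_div hr.ne' (by positivity),
      Real.log_pow, mul_sub, mul_div_cancel₀ _ h4.ne', abs_sub_comm]
    ring_nf
  refine (Finset.sum_le_sum h).trans ?_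
  rw [← Finset.mul_sum, scaleConst]
  gcongr
  exact sum_nat_one_div_one_add_sq_le _ _

theorem matB_eq (j k : ℕ) :
    matB j k = !![((4 : ℝ) ^ j)⁻¹, 0; 0, ((2 : ℝ) ^ j)⁻¹] *
      rotation (2 * k * Real.pi / 2 ^ j) := by
  rw [matB]
  refine Matrix.inv_eq_left_inv ?_
  set θ := 2 * k * Real.pi / 2 ^ j
  have h := Real.sin_sq_add_cos_sq θ
  have h4 : ((4 : ℝ) ^ j)⁻¹ * 4 ^ j = 1 := inv_mul_cancel₀ (by positivity)
  have h2 : ((2 : ℝ) ^ j)⁻¹ * 2 ^ j = 1 := inv_mul_cancel₀ (by positivity)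
  have hA : matA j k = parabolic j * rotation θ := rfl
  rw [hA]
  ext a b
  fin_cases a <;> fin_cases b <;>
    simp [parabolic, rotation, Matrix.mul_apply, Fin.sum_univ_two]
  · linear_combination h4 + (((4 : ℝ) ^ j)⁻¹ * 4 ^ j) * h
  · ring
  · ring
  · linear_combination h2 + (((2 : ℝ) ^ j)⁻¹ * 2 ^ j) * h

theorem exists_polar (ξ : Plane) :
    ∃ β, ξ 0 = ‖ξ‖ * Real.cos β ∧ ξ 1 = ‖ξ‖ * Real.sin β := by
  set z : ℂ := ⟨ξ 0, ξ 1⟩ with hz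
  have hn : ‖ξ‖ = ‖z‖ := by
    rw [EuclideanSpace.norm_eq, Fin.sum_univ_two, Complex.norm_def, Complex.normSq_apply]
    simp only [Real.norm_eq_abs, sq_abs, hz]
    ring_nf
  exact ⟨z.arg, by rw [hn, Complex.norm_mul_cos_arg], by rw [hn, Complex.norm_mul_sin_arg]⟩

theorem act_matB_polar {ξ : Plane} {β : ℝ} (h0 : ξ 0 = ‖ξ‖ * Real.cos β)
    (h1 : ξ 1 = ‖ξ‖ * Real.sin β) (j k : ℕ) :
    act (matB j k) ξ 0 = ‖ξ‖ / 4 ^ j * Real.cos (β + 2 * k * Real.pi / 2 ^ j) ∧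
    act (matB j k) ξ 1 = ‖ξ‖ / 4 ^ j * (2 ^ j * Real.sin (β + 2 * k * Real.pi / 2 ^ j)) := by
  have e : ‖ξ‖ / 4 ^ j * 2 ^ j = ‖ξ‖ / 2 ^ j := by
    rw [show (4 : ℝ) = 2 * 2 by norm_num, mul_pow]
    field_simp
  rw [← mul_assoc, e]
  generalize hθ : 2 * k * Real.pi / 2 ^ j = θ
  rw [matB_eq, hθ]
  simp [act, Matrix.toLpLin_apply, dotProduct, Fin.sum_univ_two, rotation, h0, h1, Real.cos_add,
    Real.sin_add]
  constructor <;> ring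

/-- The envelope `min 1 (|η₁| ^ ς) exp (-(δ / 2) |η|²)`. -/
def envelope (δ ς : ℝ) (η : Plane) : ℝ := min 1 (|η 0| ^ ς) * Real.exp (-(δ / 2) * ‖η‖ ^ 2)

theorem envelope_nonneg (δ ς : ℝ) (η : Plane) : 0 ≤ envelope δ ς η := by
  unfold envelope; positivity

/-- With t = |ξ| / 4 ^ j and N = 2 ^ j, B_{j,k} ξ = (t cos α, t N sin α), whose squared norm is at
least t² (1 + N² sin² α) / 2. The bound exp(-y) ≤ 1 / y then separates the scale from the angle. -/
theorem envelope_act_matB_le {δ ς : ℝ} (hδ : 0 < δ) (hς : 2 < ς) {ξ : Plane} (hξ : ξ ≠ 0)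
    {β : ℝ} (h0 : ξ 0 = ‖ξ‖ * Real.cos β) (h1 : ξ 1 = ‖ξ‖ * Real.sin β) (j k : ℕ) :
    envelope δ ς (act (matB j k) ξ) ≤
      4 / δ * (min 1 ((‖ξ‖ / 4 ^ j) ^ ς) / (‖ξ‖ / 4 ^ j) ^ 2) *
        (1 / (1 + ((2 ^ j : ℕ) : ℝ) ^ 2 *
          Real.sin (β + 2 * k * Real.pi / (2 ^ j : ℕ)) ^ 2)) := by
  obtain ⟨e0, e1⟩ := act_matB_polar h0 h1 j k
  set t := ‖ξ‖ / 4 ^ j with ht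
  have htp : 0 < t := by have := norm_pos_iff.2 hξ; positivity
  have hnorm : ‖act (matB j k) ξ‖ ^ 2 = act (matB j k) ξ 0 ^ 2 + act (matB j k) ξ 1 ^ 2 := by
    rw [EuclideanSpace.norm_sq_eq, Fin.sum_univ_two]
    simp
  rw [envelope, hnorm, e0, e1]
  push_cast
  set N : ℝ := 2 ^ j with hN
  have hN1 : 1 ≤ N := one_le_pow₀ (by norm_num)
  set α := β + 2 * k * Real.pi / N
  have hcs := Real.sin_sq_add_cos_sq α
  set X := t ^ 2 * (1 + N ^ 2 * Real.sin α ^ 2) with hX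
  have hXp : 0 < X := by positivity
  have hXle : X / 2 ≤ (t * Real.cos α) ^ 2 + (t * (N * Real.sin α)) ^ 2 := by
    have : 1 + N ^ 2 * Real.sin α ^ 2 ≤ 2 * (Real.cos α ^ 2 + N ^ 2 * Real.sin α ^ 2) := by
      have : Real.sin α ^ 2 ≤ N ^ 2 * Real.sin α ^ 2 :=
        le_mul_of_one_le_left (sq_nonneg _) (one_le_pow₀ hN1)
      nlinarith [Real.sin_sq_le_one α]
    nlinarith [mul_le_mul_of_nonneg_left this (sq_nonneg t)]
  have hexp : Real.exp (-(δ / 2) * ((t * Real.cos α) ^ 2 + (t * (N * Real.sin α)) ^ 2)) ≤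
      4 / δ * (1 / X) := by
    calc _ ≤ Real.exp (-(δ / 4 * X)) := Real.exp_le_exp.2 (by nlinarith)
      _ ≤ 1 / (δ / 4 * X) := by
        rw [Real.exp_neg, inv_eq_one_div]
        refine one_div_le_one_div_of_le (by positivity) ?_
        linarith [Real.add_one_le_exp (δ / 4 * X)]
      _ = _ := by field_simp
  have hmin : min 1 (|t * Real.cos α| ^ ς) ≤ min 1 (t ^ ς) := by
    refine min_le_min le_rfl (Real.rpow_le_rpow (abs_nonneg _) ?_ (by linarith))
    rw [abs_mul, abs_of_pos htp]
    exact mul_le_of_le_one_right htp.le (Real.abs_cos_le_one _)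
  calc _ ≤ min 1 (t ^ ς) * (4 / δ * (1 / X)) := by gcongr
    _ = _ := by rw [hX]; field_simp

/-- A uniform bound for the sum of the dilated and rotated envelopes. -/
def envelopeConst (δ ς : ℝ) : ℝ := 4 / δ * scaleConst ς * (4 * cauchyConst)

theorem scaleConst_pos (ς : ℝ) : 0 < scaleConst ς := by
  have := cauchyConst_pos
  unfold scaleConst
  positivity

theorem envelopeConst_pos {δ : ℝ} (hδ : 0 < δ) (ς : ℝ) : 0 < envelopeConst δ ς := by
  have := cauchyConst_pos
  have := scaleConst_pos ς
  unfold envelopeConst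
  positivity

theorem sum_envelope_act_matB_le {δ ς : ℝ} (hδ : 0 < δ) (hς : 2 < ς) {ξ : Plane} (hξ : ξ ≠ 0)
    (j : ℕ) :
    ∑ k : Fin (2 ^ j), envelope δ ς (act (matB j k) ξ) ≤
      4 / δ * (min 1 ((‖ξ‖ / 4 ^ j) ^ ς) / (‖ξ‖ / 4 ^ j) ^ 2) * (4 * cauchyConst) := by
  obtain ⟨β, h0, h1⟩ := exists_polar ξ
  rw [Fin.sum_univ_eq_sum_range fun k => envelope δ ς (act (matB j k) ξ)]
  refine (Finset.sum_le_sum fun k _ => envelope_act_matB_le hδ hς hξ h0 h1 j k).trans ?_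
  rw [← Finset.mul_sum]
  gcongr
  exact sum_one_div_one_add_sin_sq_le (by positivity) β

theorem tsum_envelope_act_matB_le {δ ς : ℝ} (hδ : 0 < δ) (hς : 2 < ς) (ξ : Plane) :
    ∑' j : ℕ+, ∑ k : Fin (2 ^ (j : ℕ)), ENNReal.ofReal (envelope δ ς (act (matB j k) ξ)) ≤
      ENNReal.ofReal (envelopeConst δ ς) := by
  -- The quotient bound needs |ξ| > 0; at the origin every envelope vanishes because 0 ^ ς = 0.
  rcases eq_or_ne ξ 0 with rfl | hξ
  · have : envelope δ ς 0 = 0 := by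
      simp [envelope, Real.zero_rpow (by linarith : ς ≠ 0)]
    simp [this]
  rw [ENNReal.tsum_eq_iSup_sum]
  refine iSup_le fun s => ?_
  simp only [← ENNReal.ofReal_sum_of_nonneg fun k _ => envelope_nonneg δ ς _]
  rw [← ENNReal.ofReal_sum_of_nonneg
    fun j _ => Finset.sum_nonneg fun k _ => envelope_nonneg δ ς _]
  refine ENNReal.ofReal_le_ofReal ?_
  refine (Finset.sum_le_sum fun (j : ℕ+) _ =>
    sum_envelope_act_matB_le hδ hς hξ (j : ℕ)).trans ?_
  rw [← Finset.sum_mul, ← Finset.mul_sum, envelopeConst]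
  have := cauchyConst_pos
  gcongr
  have h := sum_min_one_rpow_div_sq_le hς (norm_pos_iff.2 hξ)
    (s.map ⟨fun j : ℕ+ => (j : ℕ), PNat.coe_injective⟩)
  simpa using h

end counting

/-! ### Dual lattice sums and the off-diagonal bound -/

section lattice

/-- In an eigenbasis of T* T the form ‖T x‖² is diagonal with entries σ_i² ≤ σ_0². -/
theorem norm_apply_le_singularValues_zero {E F : Type*} [NormedAddCommGroup E]
    [InnerProductSpace ℝ E] [FiniteDimensional ℝ E] [NormedAddCommGroup F]
    [InnerProductSpace ℝ F] [FiniteDimensional ℝ F] (T : E →ₗ[ℝ] F) (x : E) :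
    ‖T x‖ ≤ T.singularValues 0 * ‖x‖ := by
  refine le_of_sq_le_sq ?_ (mul_nonneg (T.singularValues_nonneg 0) (norm_nonneg _))
  set hT := T.isSymmetric_adjoint_comp_self
  set b := hT.eigenvectorBasis rfl with hb
  have h1 : ‖T x‖ ^ 2 = inner ℝ ((LinearMap.adjoint T ∘ₗ T) x) x := by
    rw [LinearMap.comp_apply, LinearMap.adjoint_inner_left, real_inner_self_eq_norm_sq]
  have h2 : ‖x‖ ^ 2 = ∑ i, b.repr x i ^ 2 := by
    rw [← b.repr.norm_map, EuclideanSpace.norm_sq_eq]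
    simp
  rw [h1, mul_pow, h2, ← b.repr.inner_map_map, PiLp.inner_apply, Finset.mul_sum]
  refine Finset.sum_le_sum fun i _ => ?_
  rw [hT.eigenvectorBasis_apply_self_apply rfl x i, RCLike.inner_apply, ← T.sq_singularValues_fin]
  have h3 : T.singularValues i ≤ T.singularValues 0 := T.singularValues_antitone (Nat.zero_le _)
  have h4 := pow_le_pow_left₀ (T.singularValues_nonneg i) h3 2
  simp only [conj_trivial, RCLike.ofReal_real_eq_id, id_eq]
  nlinarith [mul_le_mul_of_nonneg_right h4 (sq_nonneg (b.repr x i))]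

variable {P : Matrix (Fin 2) (Fin 2) ℝ}

theorem act_injective (hP : P.det ≠ 0) : Function.Injective (act P) :=
  Function.LeftInverse.injective (act_inv_act hP)

theorem paramA_pos (hP : P.det ≠ 0) : 0 < paramA P :=
  (LinearMap.injective_iff_forall_lt_finrank_singularValues_pos _).1 (act_injective hP) 0 (by simp)

theorem paramB_pos (hP : P.det ≠ 0) : 0 < paramB P :=
  (LinearMap.injective_iff_forall_lt_finrank_singularValues_pos _).1 (act_injective hP) 1 (by simp)

/-- Writing x = Pᵀ μ gives |x|² = ⟨P x, μ⟩ ≤ a |x| |μ|, which avoids the singular values of the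
transpose. -/
theorem norm_le_paramA_mul (hP : P.det ≠ 0) (x : Plane) :
    ‖x‖ ≤ paramA P * ‖act (P.transpose)⁻¹ x‖ := by
  set μ := act (P.transpose)⁻¹ x with hμ
  have hx : x = act P.transpose μ := (act_transpose_act_inv hP x).symm
  have h1 : ‖x‖ * ‖x‖ ≤ paramA P * ‖x‖ * ‖μ‖ := by
    calc ‖x‖ * ‖x‖ = inner ℝ (act P x) μ := by
          rw [inner_act, ← hx, real_inner_self_eq_norm_mul_norm]
      _ ≤ ‖act P x‖ * ‖μ‖ := real_inner_le_norm _ _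
      _ ≤ _ := by gcongr; exact norm_apply_le_singularValues_zero _ _
  rcases (norm_nonneg x).eq_or_lt with h | h
  · rw [← h]; exact mul_nonneg (paramA_pos hP).le (norm_nonneg _)
  · nlinarith

/-- From |μ| ≥ |l| / a, the exponent 2 τ |μ|² is split in halves: |l| ≥ 1 makes one at least τ / a²,
and a² ≤ τ makes the other at least |l|², which gives summability over l. -/
theorem exp_neg_mul_sq_norm_dual_le {τ : ℝ} (hτ : 0 < τ) (hP : P.det ≠ 0)
    (ha : paramA P ^ 2 ≤ τ) {l : Fin 2 → ℤ} (hl : l ≠ 0) :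
    Real.exp (-(2 * τ) * ‖act (P.transpose)⁻¹ (WithLp.toLp 2 (intVec l))‖ ^ 2) ≤
      Real.exp (-τ / paramA P ^ 2) * (1 / (1 + (l 0 : ℝ) ^ 2) * (1 / (1 + (l 1 : ℝ) ^ 2))) := by
  set a := paramA P
  have hap : 0 < a := paramA_pos hP
  set x : Plane := WithLp.toLp 2 (intVec l) with hx
  set μ := act (P.transpose)⁻¹ x
  have hxn : ‖x‖ ^ 2 = (l 0 : ℝ) ^ 2 + (l 1 : ℝ) ^ 2 := by
    rw [EuclideanSpace.norm_sq_eq, Fin.sum_univ_two]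
    simp [hx, intVec]
  have hx1 : 1 ≤ ‖x‖ ^ 2 := by
    rw [hxn]
    have : 0 < l 0 ^ 2 + l 1 ^ 2 := by
      by_contra h
      refine hl (funext fun i => ?_)
      fin_cases i <;> simp <;> nlinarith [sq_nonneg (l 0), sq_nonneg (l 1)]
    exact_mod_cast this
  have h1 : ‖x‖ ^ 2 ≤ a ^ 2 * ‖μ‖ ^ 2 := by
    rw [← mul_pow]
    exact pow_le_pow_left₀ (norm_nonneg _) (norm_le_paramA_mul hP x) 2
  have h2 : τ / a ^ 2 + ‖x‖ ^ 2 ≤ 2 * τ * ‖μ‖ ^ 2 := by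
    have ha2 : 0 < a ^ 2 := by positivity
    have h3 : ‖x‖ ^ 2 / a ^ 2 ≤ ‖μ‖ ^ 2 := by rw [div_le_iff₀ ha2]; linarith
    have h4 : 1 / a ^ 2 ≤ ‖x‖ ^ 2 / a ^ 2 := by gcongr
    have h5 : ‖x‖ ^ 2 ≤ τ * (‖x‖ ^ 2 / a ^ 2) := by
      rw [← mul_div_assoc, le_div_iff₀ ha2, mul_comm]
      exact mul_le_mul_of_nonneg_right ha (sq_nonneg _)
    have h6 : τ / a ^ 2 = τ * (1 / a ^ 2) := by ring
    nlinarith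
  have h7 : ∀ y : ℝ, Real.exp (-y ^ 2) ≤ 1 / (1 + y ^ 2) := fun y => by
    rw [Real.exp_neg, inv_eq_one_div]
    exact one_div_le_one_div_of_le (by positivity) (by linarith [Real.add_one_le_exp (y ^ 2)])
  calc _ ≤ Real.exp (-τ / a ^ 2 + (-(l 0 : ℝ) ^ 2 + -(l 1 : ℝ) ^ 2)) := by
        refine Real.exp_le_exp.2 ?_
        rw [neg_div]
        linarith
    _ ≤ _ := by
        rw [Real.exp_add, Real.exp_add]
        gcongr
        · exact h7 _
        · exact h7 _

/-- The sum over `ℤ²` of `1 / ((1 + l₀²) (1 + l₁²))`. -/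
def latticeConst : ℝ := (cauchyConst / 3) ^ 2

theorem latticeConst_pos : 0 < latticeConst := by
  have := cauchyConst_pos
  unfold latticeConst; positivity

theorem tsum_lattice_weight : ∑' l : Fin 2 → ℤ,
    ENNReal.ofReal (1 / (1 + (l 0 : ℝ) ^ 2) * (1 / (1 + (l 1 : ℝ) ^ 2))) =
      ENNReal.ofReal latticeConst := by
  have h : ∑' n : ℤ, ENNReal.ofReal (1 / (1 + (n : ℝ) ^ 2)) =
      ENNReal.ofReal (cauchyConst / 3) := by
    rw [← ENNReal.ofReal_tsum_of_nonneg (fun n => by positivity) summable_one_div_one_add_sq,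
      cauchyConst, mul_div_cancel_left₀ _ (by norm_num)]
  rw [latticeConst, sq, ENNReal.ofReal_mul (by have := cauchyConst_pos; positivity), ← h,
    ← (finTwoArrowEquiv ℤ).symm.tsum_eq, ENNReal.tsum_prod', ← ENNReal.tsum_mul_right]
  refine tsum_congr fun a => ?_
  rw [← ENNReal.tsum_mul_left]
  refine tsum_congr fun b => ?_
  rw [← ENNReal.ofReal_mul (by positivity)]
  simp

/-- Since |μ|² ≤ 2 |η|² + 2 |η + μ|², half of the total Gaussian exponent pays for δ |μ|² / 4. The
other half keeps the envelope at the chosen point; the factor m ≤ 1 at the other point is dropped.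
-/
theorem ae_mul_shift_le {ψ : L2} {δ K : ℝ} (hδ : 0 < δ) {m : Plane → ℝ}
    (hm0 : ∀ η, 0 ≤ m η) (hm1 : ∀ η, m η ≤ 1)
    (hψ : ∀ᵐ η : Plane, ‖ψ η‖ ≤ K * (m η * Real.exp (-δ * ‖η‖ ^ 2))) (μ : Plane) :
    ∀ᵐ η : Plane,
      ‖ψ η‖ * ‖ψ (η + μ)‖ ≤ K ^ 2 * Real.exp (-(δ / 4) * ‖μ‖ ^ 2) *
        (m η * Real.exp (-(δ / 2) * ‖η‖ ^ 2)) ∧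
      ‖ψ η‖ * ‖ψ (η + μ)‖ ≤ K ^ 2 * Real.exp (-(δ / 4) * ‖μ‖ ^ 2) *
        (m (η + μ) * Real.exp (-(δ / 2) * ‖η + μ‖ ^ 2)) := by
  filter_upwards [hψ,
    (measurePreserving_add_right volume μ).quasiMeasurePreserving.ae hψ] with η h1 h2
  have hμ : ‖μ‖ ^ 2 ≤ 2 * ‖η‖ ^ 2 + 2 * ‖η + μ‖ ^ 2 := by
    have h3 : ‖μ‖ ≤ ‖η‖ + ‖η + μ‖ := by
      calc ‖μ‖ = ‖(η + μ) - η‖ := by rw [add_sub_cancel_left]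
        _ ≤ _ := by rw [add_comm ‖η‖]; exact norm_sub_le _ _
    have h4 := pow_le_pow_left₀ (norm_nonneg _) h3 2
    nlinarith [sq_nonneg (‖η‖ - ‖η + μ‖)]
  have hmul : ‖ψ η‖ * ‖ψ (η + μ)‖ ≤ K ^ 2 * (m η * m (η + μ) *
      Real.exp (-δ * ‖η‖ ^ 2 + -δ * ‖η + μ‖ ^ 2)) := by
    calc _ ≤ (K * (m η * Real.exp (-δ * ‖η‖ ^ 2))) *
          (K * (m (η + μ) * Real.exp (-δ * ‖η + μ‖ ^ 2))) :=
        mul_le_mul h1 h2 (norm_nonneg _) ((norm_nonneg _).trans h1)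
      _ = _ := by rw [Real.exp_add]; ring
  have hnn : 0 ≤ m η * m (η + μ) := mul_nonneg (hm0 _) (hm0 _)
  constructor
  · calc _ ≤ _ := hmul
      _ ≤ K ^ 2 * (m η * Real.exp (-(δ / 4) * ‖μ‖ ^ 2 + -(δ / 2) * ‖η‖ ^ 2)) := by
        refine mul_le_mul_of_nonneg_left (mul_le_mul
          (mul_le_of_le_one_right (hm0 _) (hm1 _)) (Real.exp_le_exp.2 ?_) (Real.exp_nonneg _)
          (hm0 _)) (sq_nonneg K)
        nlinarith [sq_nonneg ‖η + μ‖]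
      _ = _ := by rw [Real.exp_add]; ring
  · calc _ ≤ _ := hmul
      _ ≤ K ^ 2 * (m (η + μ) * Real.exp (-(δ / 4) * ‖μ‖ ^ 2 + -(δ / 2) * ‖η + μ‖ ^ 2)) := by
        refine mul_le_mul_of_nonneg_left (mul_le_mul
          (mul_le_of_le_one_left (hm0 _) (hm1 _)) (Real.exp_le_exp.2 ?_) (Real.exp_nonneg _)
          (hm0 _)) (sq_nonneg K)
        nlinarith [sq_nonneg ‖η‖]
      _ = _ := by rw [Real.exp_add]; ring

/-- The off-diagonal contribution of a window with Gaussian decay. -/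
theorem offDiagonal_fiber_le_of_decay {M : Matrix (Fin 2) (Fin 2) ℝ} (hM : M.det ≠ 0)
    (hP : P.det ≠ 0) (f φ : L2) {τ K : ℝ} (hτ : 0 < τ) (hK : 0 < K) (ha : paramA P ^ 2 ≤ τ)
    {m : Plane → ℝ} (hm : Measurable m) (hm0 : ∀ η, 0 ≤ m η) (hm1 : ∀ η, m η ≤ 1)
    (hφ : ∀ᵐ η : Plane, ‖(𝓕 φ : L2) η‖ ≤ K * (m η * Real.exp (-(8 * τ) * ‖η‖ ^ 2))) :
    ENNReal.ofReal (|M.det| / |P.det| ^ 2) * offDiagonal (fiber M P (𝓕 f : L2) (𝓕 φ : L2)) ≤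
      ENNReal.ofReal |P.det|⁻¹ *
        (ENNReal.ofReal (2 * K ^ 2 * latticeConst * Real.exp (-τ / paramA P ^ 2)) *
        ∫⁻ ξ, ‖(𝓕 f : L2) ξ‖ₑ ^ 2 * ENNReal.ofReal (m (act (M.transpose)⁻¹ ξ) *
          Real.exp (-(8 * τ / 2) * ‖act (M.transpose)⁻¹ ξ‖ ^ 2))) := by
  set κ := Real.exp (-τ / paramA P ^ 2)
  set v : Plane → ℝ≥0∞ := fun η => ENNReal.ofReal (m η * Real.exp (-(8 * τ / 2) * ‖η‖ ^ 2))
    with hv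
  set w : (Fin 2 → ℤ) → ℝ≥0∞ := fun l => ENNReal.ofReal (K ^ 2 * κ) *
    ENNReal.ofReal (1 / (1 + (l 0 : ℝ) ^ 2) * (1 / (1 + (l 1 : ℝ) ^ 2))) with hwdef
  have hvm : Measurable v := by fun_prop
  have hstep : ∀ (s : ℝ) (x : Plane) (l : Fin 2 → ℤ), l ≠ 0 →
      s ≤ K ^ 2 * Real.exp (-(8 * τ / 4) *
        ‖act (P.transpose)⁻¹ (WithLp.toLp 2 (intVec l))‖ ^ 2) *
        (m x * Real.exp (-(8 * τ / 2) * ‖x‖ ^ 2)) →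
      ENNReal.ofReal s ≤ w l * v x := by
    intro s x l hl hs
    have hmx : 0 ≤ m x * Real.exp (-(8 * τ / 2) * ‖x‖ ^ 2) :=
      mul_nonneg (hm0 _) (Real.exp_nonneg _)
    simp only [hwdef, hv]
    rw [← ENNReal.ofReal_mul (by positivity), ← ENNReal.ofReal_mul (by positivity)]
    refine ENNReal.ofReal_le_ofReal (hs.trans (mul_le_mul_of_nonneg_right ?_ hmx))
    rw [mul_assoc]
    refine mul_le_mul_of_nonneg_left ?_ (sq_nonneg K)
    rw [show 8 * τ / 4 = 2 * τ by ring]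
    exact exp_neg_mul_sq_norm_dual_le hτ hP ha hl
  refine (offDiagonal_fiber_le hM hP f φ hvm w fun l hl => ?_).trans ?_
  · filter_upwards [ae_mul_shift_le (by positivity) hm0 hm1 hφ
      (act (P.transpose)⁻¹ (WithLp.toLp 2 (intVec l)))] with η hη
    rw [← ofReal_norm, ← ofReal_norm, ← ENNReal.ofReal_mul (norm_nonneg _)]
    exact ⟨hstep _ _ l hl hη.1, hstep _ _ l hl hη.2⟩
  · gcongr
    calc 2 * ∑' l : Fin 2 → ℤ, (if l = 0 then 0 else w l) ≤ 2 * ∑' l, w l := by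
          gcongr with l
          split_ifs <;> simp
      _ = _ := by
          rw [hwdef, ENNReal.tsum_mul_left, tsum_lattice_weight,
            ← ENNReal.ofReal_mul (by positivity), ← ENNReal.ofReal_ofNat 2,
            ← ENNReal.ofReal_mul (by norm_num)]
          congr 1
          ring

end lattice

/-! ### Assembly of the frame bounds and the limit of their ratio -/

section frame

theorem coarsePacket_eq (φ₀ : L2) (y : Plane) :
    coarsePacket φ₀ y = ((1 : ℝ) : ℂ) • affinePacket (M := 1) (by simp) φ₀ y := by
  rw [Complex.ofReal_one, one_smul]
  refine Lp.ext ?_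
  filter_upwards [MemLp.coeFn_toLp (memLp_comp_sub y (Lp.memLp φ₀)),
    weightComp_coe (M := 1) (by simp) y (w := fun _ => 1) continuous_const (by simp) φ₀]
    with x h1 h2
  rw [coarsePacket, h1, affinePacket, h2, one_mul, affineHomeo_apply, act_one]

theorem det_matA_ne_zero (j k : ℕ) : (matA j k).det ≠ 0 := by rw [det_matA]; positivity

theorem packet_eq (φ : L2) (j k : ℕ) (y : Plane) :
    packet φ j k y = (((8 : ℝ) ^ ((j : ℝ) / 2) : ℝ) : ℂ) •
      affinePacket (det_matA_ne_zero j k) φ y := by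
  refine Lp.ext ?_
  filter_upwards [MemLp.coeFn_toLp (memLp_packet φ j k y),
    Lp.coeFn_smul (((8 : ℝ) ^ ((j : ℝ) / 2) : ℝ) : ℂ) (affinePacket (det_matA_ne_zero j k) φ y),
    weightComp_coe (det_matA_ne_zero j k) y (w := fun _ => 1) continuous_const (by simp) φ]
    with x h1 h2 h3
  rw [packet, h1, h2, Pi.smul_apply, affinePacket, h3, one_mul, affineHomeo_apply, smul_eq_mul]

theorem sq_eight_rpow_half (j k : ℕ) : ((8 : ℝ) ^ ((j : ℝ) / 2)) ^ 2 = |(matA j k).det| := by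
  rw [det_matA, abs_of_pos (by positivity), ← Real.rpow_natCast, ← Real.rpow_mul (by norm_num)]
  norm_num

variable {P : Matrix (Fin 2) (Fin 2) ℝ}

theorem tsum_lattice (hP : P.det ≠ 0) (F : Plane → ℝ≥0∞) :
    ∑' y : lattice P, F y = ∑' n : Fin 2 → ℤ, F (act P (WithLp.toLp 2 (intVec n))) := by
  have hinj : Function.Injective
      fun n : Fin 2 → ℤ => act P (WithLp.toLp 2 fun i => (n i : ℝ)) := by
    intro m n h
    have h1 := WithLp.toLp_injective 2 (act_injective hP h)
    ext i
    exact_mod_cast congrFun h1 i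
  exact ((Equiv.ofInjective _ hinj).tsum_eq fun y : lattice P => F y).symm

/-- The sum of the squared moduli of the coefficients of `f` in the wavepacket system. -/
def coeffSum (φ₀ φ : L2) (P : Matrix (Fin 2) (Fin 2) ℝ) (f : L2) : ℝ≥0∞ :=
  ∑' i, ‖inner ℂ f (system φ₀ φ P i)‖ₑ ^ 2

theorem coeffSum_eq (hP : P.det ≠ 0) (φ₀ φ f : L2) :
    coeffSum φ₀ φ P f =
      (∑' n : Fin 2 → ℤ, ‖inner ℂ f (((1 : ℝ) : ℂ) • affinePacket (M := 1) (by simp) φ₀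
        (act P (WithLp.toLp 2 (intVec n))))‖ₑ ^ 2) +
      ∑' j : ℕ+, ∑ k : Fin (2 ^ (j : ℕ)), ∑' n : Fin 2 → ℤ,
        ‖inner ℂ f ((((8 : ℝ) ^ (((j : ℕ) : ℝ) / 2) : ℝ) : ℂ) •
          affinePacket (det_matA_ne_zero j k) φ (act P (WithLp.toLp 2 (intVec n))))‖ₑ ^ 2 := by
  rw [coeffSum, Summable.tsum_sum ENNReal.summable ENNReal.summable, ENNReal.tsum_prod',
    ENNReal.tsum_sigma']
  simp only [system, coarsePacket_eq, packet_eq, tsum_fintype]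
  congr 1
  · exact tsum_lattice hP fun y => ‖inner ℂ f (((1 : ℝ) : ℂ) •
      affinePacket (M := 1) (by simp) φ₀ y)‖ₑ ^ 2
  · refine tsum_congr fun j => Finset.sum_congr rfl fun k _ => ?_
    exact tsum_lattice hP fun y => ‖inner ℂ f ((((8 : ℝ) ^ (((j : ℕ) : ℝ) / 2) : ℝ) : ℂ) •
      affinePacket (det_matA_ne_zero j k) φ y)‖ₑ ^ 2

/-- Integrating a weighted sum of dilated and rotated profiles against `|g|²`. -/
theorem lintegral_mul_add_tsum {F u : Plane → ℝ≥0∞} {v : Plane → ℝ≥0∞} (hF : Measurable F)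
    (hu : Measurable u) (hv : Measurable v) :
    (∫⁻ ξ, F ξ * u ξ) + ∑' j : ℕ+, ∑ k : Fin (2 ^ (j : ℕ)), ∫⁻ ξ, F ξ * v (act (matB j k) ξ) =
      ∫⁻ ξ, F ξ * (u ξ + ∑' j : ℕ+, ∑ k : Fin (2 ^ (j : ℕ)), v (act (matB j k) ξ)) := by
  have hvm : ∀ j k : ℕ, Measurable fun ξ => v (act (matB j k) ξ) := fun j k =>
    hv.comp (continuous_act _).measurable
  have hsm : ∀ j : ℕ, Measurable fun ξ => ∑ k : Fin (2 ^ j), F ξ * v (act (matB j k) ξ) :=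
    fun j => Finset.measurable_sum _ fun k _ => hF.mul (hvm j k)
  simp only [mul_add, ← ENNReal.tsum_mul_left, Finset.mul_sum]
  have hFu : Measurable fun ξ => F ξ * u ξ := hF.mul hu
  rw [lintegral_add_left hFu, lintegral_tsum fun j : ℕ+ => (hsm j).aemeasurable]
  congr 1
  refine tsum_congr fun j => ?_
  have hk : ∀ k : Fin (2 ^ (j : ℕ)), Measurable fun ξ => F ξ * v (act (matB j k) ξ) :=
    fun k => hF.mul (hvm j k)
  exact (lintegral_finsetSum _ fun k _ => hk k).symm

/-- The diagonal terms add up exactly to the covering function integrated against |f^|²; this is the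
only way the covering condition enters the main term. -/
theorem energy_add_tsum (φ₀ φ f : L2) :
    energy 1 f φ₀ + ∑' j : ℕ+, ∑ k : Fin (2 ^ (j : ℕ)), energy (matA j k) f φ =
      ∫⁻ ξ, ‖(𝓕 f : L2) ξ‖ₑ ^ 2 * coveringSum φ₀ φ ξ := by
  have h1 : energy 1 f φ₀ = ∫⁻ ξ, ‖(𝓕 f : L2) ξ‖ₑ ^ 2 * ‖(𝓕 φ₀ : L2) ξ‖ₑ ^ 2 := by
    simp only [energy, Matrix.transpose_one, inv_one, act_one]
  rw [h1]
  exact lintegral_mul_add_tsum ((Lp.stronglyMeasurable _).measurable.enorm.pow_const 2)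
    ((Lp.stronglyMeasurable _).measurable.enorm.pow_const 2)
    ((Lp.stronglyMeasurable (𝓕 φ : L2)).measurable.enorm.pow_const 2)

theorem lintegral_enorm_sq (f : L2) : ∫⁻ ξ, ‖f ξ‖ₑ ^ 2 = ENNReal.ofReal (‖f‖ ^ 2) := by
  rw [ENNReal.ofReal_pow (norm_nonneg _), ofReal_norm, Lp.enorm_def,
    eLpNorm_eq_lintegral_rpow_enorm_toReal (by norm_num) (by norm_num), ← ENNReal.rpow_natCast,
    ← ENNReal.rpow_mul]
  norm_num

theorem lintegral_enorm_fourier_sq (f : L2) :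
    ∫⁻ ξ, ‖(𝓕 f : L2) ξ‖ₑ ^ 2 = ENNReal.ofReal (‖f‖ ^ 2) := by
  rw [lintegral_enorm_sq, Lp.norm_fourier_eq]

theorem energy_bounds {φ₀ φ : L2} {A B : ℝ} (h : Covering φ₀ φ A B) (f : L2) :
    ENNReal.ofReal A * ENNReal.ofReal (‖f‖ ^ 2) ≤
        energy 1 f φ₀ + ∑' j : ℕ+, ∑ k : Fin (2 ^ (j : ℕ)), energy (matA j k) f φ ∧
      energy 1 f φ₀ + ∑' j : ℕ+, ∑ k : Fin (2 ^ (j : ℕ)), energy (matA j k) f φ ≤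
        ENNReal.ofReal B * ENNReal.ofReal (‖f‖ ^ 2) := by
  have hm : Measurable fun ξ => ‖(𝓕 f : L2) ξ‖ₑ ^ 2 :=
    (Lp.stronglyMeasurable _).measurable.enorm.pow_const 2
  rw [energy_add_tsum, ← lintegral_enorm_fourier_sq, ← lintegral_const_mul _ hm,
    ← lintegral_const_mul _ hm]
  constructor
  · refine lintegral_mono_ae (h.2.mono fun ξ hξ => ?_)
    rw [mul_comm]
    exact mul_le_mul_right hξ.1 _
  · refine lintegral_mono_ae (h.2.mono fun ξ hξ => ?_)
    rw [mul_comm (ENNReal.ofReal B)]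
    exact mul_le_mul_right hξ.2 _

/-- The off-diagonal term of the affine system with matrix `M`. -/
def remainder (M P : Matrix (Fin 2) (Fin 2) ℝ) (f φ : L2) : ℝ≥0∞ :=
  ENNReal.ofReal (|M.det| / |P.det| ^ 2) * offDiagonal (fiber M P (𝓕 f : L2) (𝓕 φ : L2))

/-- The sum of all off-diagonal terms of the wavepacket system. -/
def totalRemainder (φ₀ φ : L2) (P : Matrix (Fin 2) (Fin 2) ℝ) (f : L2) : ℝ≥0∞ :=
  remainder 1 P f φ₀ + ∑' j : ℕ+, ∑ k : Fin (2 ^ (j : ℕ)), remainder (matA j k) P f φ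

theorem coeffSum_le (hP : P.det ≠ 0) {φ₀ φ : L2} {A B : ℝ} (h : Covering φ₀ φ A B) (f : L2) :
    coeffSum φ₀ φ P f ≤ ENNReal.ofReal |P.det|⁻¹ *
      (ENNReal.ofReal B * ENNReal.ofReal (‖f‖ ^ 2)) + totalRemainder φ₀ φ P f := by
  rw [coeffSum_eq hP]
  calc _ ≤ (ENNReal.ofReal |P.det|⁻¹ * energy 1 f φ₀ + remainder 1 P f φ₀) +
        ∑' j : ℕ+, ∑ k : Fin (2 ^ (j : ℕ)), (ENNReal.ofReal |P.det|⁻¹ * energy (matA j k) f φ +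
          remainder (matA j k) P f φ) := by
        refine add_le_add (tsum_enorm_inner_affinePacket_le _ hP f φ₀ 1 (by simp))
          (ENNReal.tsum_le_tsum fun j => Finset.sum_le_sum fun k _ => ?_)
        exact tsum_enorm_inner_affinePacket_le _ hP f φ _ (sq_eight_rpow_half j k)
    _ = ENNReal.ofReal |P.det|⁻¹ * (energy 1 f φ₀ +
          ∑' j : ℕ+, ∑ k : Fin (2 ^ (j : ℕ)), energy (matA j k) f φ) +
            totalRemainder φ₀ φ P f := by
        simp only [totalRemainder, Finset.sum_add_distrib, ENNReal.tsum_add, mul_add,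
          ← ENNReal.tsum_mul_left, Finset.mul_sum]
        abel
    _ ≤ _ := by
        gcongr
        exact (energy_bounds h f).2

theorem le_coeffSum (hP : P.det ≠ 0) {φ₀ φ : L2} {A B : ℝ} (h : Covering φ₀ φ A B) (f : L2) :
    ENNReal.ofReal |P.det|⁻¹ * (ENNReal.ofReal A * ENNReal.ofReal (‖f‖ ^ 2)) ≤
      coeffSum φ₀ φ P f + totalRemainder φ₀ φ P f := by
  -- The lower estimate for each M requires finite energy, which follows from the upper covering
  -- bound.
  have hfin : energy 1 f φ₀ + ∑' j : ℕ+, ∑ k : Fin (2 ^ (j : ℕ)), energy (matA j k) f φ ≠ ∞ :=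
    ne_top_of_le_ne_top (ENNReal.mul_ne_top ENNReal.ofReal_ne_top ENNReal.ofReal_ne_top)
      (energy_bounds h f).2
  rw [ENNReal.add_ne_top] at hfin
  have hjk : ∀ (j : ℕ+) (k : Fin (2 ^ (j : ℕ))), energy (matA j k) f φ ≠ ∞ := fun j k =>
    ENNReal.sum_ne_top.1 (ENNReal.ne_top_of_tsum_ne_top hfin.2 j) k (Finset.mem_univ k)
  rw [coeffSum_eq hP]
  calc _ ≤ ENNReal.ofReal |P.det|⁻¹ * (energy 1 f φ₀ +
          ∑' j : ℕ+, ∑ k : Fin (2 ^ (j : ℕ)), energy (matA j k) f φ) := by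
        gcongr
        exact (energy_bounds h f).1
    _ = ENNReal.ofReal |P.det|⁻¹ * energy 1 f φ₀ + ∑' j : ℕ+, ∑ k : Fin (2 ^ (j : ℕ)),
          ENNReal.ofReal |P.det|⁻¹ * energy (matA j k) f φ := by
        simp only [mul_add, ← ENNReal.tsum_mul_left, Finset.mul_sum]
    _ ≤ ((∑' n : Fin 2 → ℤ, ‖inner ℂ f (((1 : ℝ) : ℂ) • affinePacket (M := 1) (by simp) φ₀
        (act P (WithLp.toLp 2 (intVec n))))‖ₑ ^ 2) + remainder 1 P f φ₀) +
      ∑' j : ℕ+, ∑ k : Fin (2 ^ (j : ℕ)), ((∑' n : Fin 2 → ℤ,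
        ‖inner ℂ f ((((8 : ℝ) ^ (((j : ℕ) : ℝ) / 2) : ℝ) : ℂ) •
          affinePacket (det_matA_ne_zero j k) φ (act P (WithLp.toLp 2 (intVec n))))‖ₑ ^ 2) +
            remainder (matA j k) P f φ) := by
        refine add_le_add
          (energy_le_tsum_enorm_inner_affinePacket _ hP f φ₀ 1 (by simp) hfin.1)
          (ENNReal.tsum_le_tsum fun j => Finset.sum_le_sum fun k _ => ?_)
        exact energy_le_tsum_enorm_inner_affinePacket _ hP f φ _ (sq_eight_rpow_half j k)
          (hjk j k)
    _ = _ := by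
        simp only [totalRemainder, Finset.sum_add_distrib, ENNReal.tsum_add]
        abel

theorem measurable_min_one_rpow (ς : ℝ) : Measurable fun η : Plane => min 1 (|η 0| ^ ς) := by
  have : Measurable fun η : Plane => η 0 :=
    (EuclideanSpace.proj (𝕜 := ℝ) (0 : Fin 2)).continuous.measurable
  have h2 : Measurable fun η : Plane => |η 0| := continuous_abs.measurable.comp this
  exact measurable_const.min (h2.pow_const ς)

/-- The off-diagonal constant does not depend on M, so summing over (j, k) only sums the envelopes
at B_{j,k} ξ; the coarse packets contribute the 1 in 1 + E. -/
theorem totalRemainder_le (hP : P.det ≠ 0) {φ₀ φ : L2} {τ ς K : ℝ} (hτ : 0 < τ) (hς : 2 < ς)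
    (hK : 0 < K) (ha : paramA P ^ 2 ≤ τ) (h₀ : CoarseDecay φ₀ (8 * τ) K)
    (h : WindowDecay φ (8 * τ) ς K) (f : L2) :
    totalRemainder φ₀ φ P f ≤ ENNReal.ofReal |P.det|⁻¹ *
      (ENNReal.ofReal (2 * K ^ 2 * latticeConst * (1 + envelopeConst (8 * τ) ς) *
        Real.exp (-τ / paramA P ^ 2)) * ENNReal.ofReal (‖f‖ ^ 2)) := by
  set c := 2 * K ^ 2 * latticeConst * Real.exp (-τ / paramA P ^ 2) with hc
  have hS := latticeConst_pos
  have hE := envelopeConst_pos (δ := 8 * τ) (by positivity) ς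
  set F : Plane → ℝ≥0∞ := fun ξ => ‖(𝓕 f : L2) ξ‖ₑ ^ 2
  have hF : Measurable F := (Lp.stronglyMeasurable _).measurable.enorm.pow_const 2
  set v : Plane → ℝ≥0∞ := fun η => ENNReal.ofReal (envelope (8 * τ) ς η)
  have hv : Measurable v := by
    have h1 := measurable_min_one_rpow ς
    have h2 : Measurable fun η : Plane => Real.exp (-(8 * τ / 2) * ‖η‖ ^ 2) := by fun_prop
    exact (h1.mul h2).ennreal_ofReal
  have hcoarse : remainder 1 P f φ₀ ≤ ENNReal.ofReal |P.det|⁻¹ * (ENNReal.ofReal c *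
      ∫⁻ ξ, F ξ * 1) := by
    refine (offDiagonal_fiber_le_of_decay (M := 1) (m := fun _ => 1) (by simp) hP f φ₀ hτ hK ha
      measurable_const (by simp) (by simp) (by simpa [CoarseDecay] using h₀)).trans ?_
    gcongr with ξ
    rw [ENNReal.ofReal_le_one, one_mul, Real.exp_le_one_iff]
    nlinarith [sq_nonneg ‖act (Matrix.transpose 1)⁻¹ ξ‖]
  have hfine : ∀ j k : ℕ, remainder (matA j k) P f φ ≤ ENNReal.ofReal |P.det|⁻¹ *
      (ENNReal.ofReal c * ∫⁻ ξ, F ξ * v (act (matB j k) ξ)) := fun j k =>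
    offDiagonal_fiber_le_of_decay (M := matA j k) (m := fun η => min 1 (|η 0| ^ ς))
      (det_matA_ne_zero j k) hP f φ hτ hK ha (measurable_min_one_rpow ς)
      (fun η => by positivity) (fun η => min_le_left _ _) h
  calc totalRemainder φ₀ φ P f ≤ ENNReal.ofReal |P.det|⁻¹ * (ENNReal.ofReal c *
        ∫⁻ ξ, F ξ * 1) + ∑' j : ℕ+, ∑ k : Fin (2 ^ (j : ℕ)), ENNReal.ofReal |P.det|⁻¹ *
      (ENNReal.ofReal c * ∫⁻ ξ, F ξ * v (act (matB j k) ξ)) :=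
        add_le_add hcoarse
          (ENNReal.tsum_le_tsum fun j => Finset.sum_le_sum fun k _ => hfine j k)
    _ = ENNReal.ofReal |P.det|⁻¹ * (ENNReal.ofReal c * ((∫⁻ ξ, F ξ * 1) +
        ∑' j : ℕ+, ∑ k : Fin (2 ^ (j : ℕ)), ∫⁻ ξ, F ξ * v (act (matB j k) ξ))) := by
        simp only [mul_add, ← ENNReal.tsum_mul_left, Finset.mul_sum]
    _ ≤ ENNReal.ofReal |P.det|⁻¹ * (ENNReal.ofReal c *
        ∫⁻ ξ, F ξ * (1 + ENNReal.ofReal (envelopeConst (8 * τ) ς))) := by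
        rw [lintegral_mul_add_tsum hF measurable_const hv]
        gcongr with ξ
        exact tsum_envelope_act_matB_le (by positivity) hς ξ
    _ = _ := by
        rw [lintegral_mul_const _ hF, lintegral_enorm_fourier_sq, ← ENNReal.ofReal_one,
          ← ENNReal.ofReal_add zero_le_one hE.le, mul_comm (ENNReal.ofReal (‖f‖ ^ 2)),
          ← mul_assoc (ENNReal.ofReal c), ← ENNReal.ofReal_mul (by positivity)]
        congr 3
        rw [hc]
        ring

theorem hasFrameBounds_of_coeffSum {φ₀ φ : L2} {α β : ℝ}
    (h : ∀ f : L2, ENNReal.ofReal (α * ‖f‖ ^ 2) ≤ coeffSum φ₀ φ P f ∧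
      coeffSum φ₀ φ P f ≤ ENNReal.ofReal (β * ‖f‖ ^ 2)) (hβ : 0 ≤ β) :
    HasFrameBounds (system φ₀ φ P) α β := by
  intro f
  have e : ∀ i, ‖inner ℂ f (system φ₀ φ P i)‖ₑ ^ 2 =
      ENNReal.ofReal (‖inner ℂ f (system φ₀ φ P i)‖ ^ 2) := fun i => by
    rw [ENNReal.ofReal_pow (norm_nonneg _), ofReal_norm]
  have hs : Summable fun i => ‖inner ℂ f (system φ₀ φ P i)‖ ^ 2 := by
    have h1 : coeffSum φ₀ φ P f ≠ ∞ := ne_top_of_le_ne_top ENNReal.ofReal_ne_top (h f).2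
    simpa using ENNReal.summable_toReal h1
  have hT : coeffSum φ₀ φ P f = ENNReal.ofReal (∑' i, ‖inner ℂ f (system φ₀ φ P i)‖ ^ 2) := by
    rw [ENNReal.ofReal_tsum_of_nonneg (fun _ => by positivity) hs, coeffSum]
    exact tsum_congr e
  have h1 := h f
  rw [hT] at h1
  exact ⟨hs, (ENNReal.ofReal_le_ofReal_iff (tsum_nonneg fun _ => by positivity)).1 h1.1,
    (ENNReal.ofReal_le_ofReal_iff (by positivity)).1 h1.2⟩

theorem HasFrameBounds.mono {ι H : Type*} [NormedAddCommGroup H] [InnerProductSpace ℂ H]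
    {e : ι → H} {α β α' β' : ℝ} (h : HasFrameBounds e α β) (hα : α' ≤ α) (hβ : β ≤ β') :
    HasFrameBounds e α' β' := fun f =>
  ⟨(h f).1, (mul_le_mul_of_nonneg_right hα (sq_nonneg _)).trans (h f).2.1,
    (h f).2.2.trans (mul_le_mul_of_nonneg_right hβ (sq_nonneg _))⟩

theorem Covering.exists_bounds {φ₀ φ : L2} {A B : ℝ} (h : Covering φ₀ φ A B) :
    ∃ ξ, ENNReal.ofReal A ≤ coveringSum φ₀ φ ξ ∧ coveringSum φ₀ φ ξ ≤ ENNReal.ofReal B :=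
  h.2.exists

theorem Covering.le {φ₀ φ : L2} {A B : ℝ} (h : Covering φ₀ φ A B) : A ≤ B := by
  obtain ⟨ξ, h1, h2⟩ := h.exists_bounds
  have h3 := h1.trans h2
  by_contra hAB
  rw [ENNReal.ofReal_le_ofReal_iff'] at h3
  rcases h3 with h3 | h3
  · exact hAB h3
  · linarith [h.1]

/-- The frame inequalities with the constants given by the off-diagonal estimate. -/
theorem hasFrameBounds_system (hP : P.det ≠ 0) {φ₀ φ : L2} {τ ς K A B : ℝ} (hτ : 0 < τ)
    (hς : 2 < ς) (hK : 0 < K) (ha : paramA P ^ 2 ≤ τ) (hcov : Covering φ₀ φ A B)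
    (h₀ : CoarseDecay φ₀ (8 * τ) K) (h : WindowDecay φ (8 * τ) ς K) {ρ : ℝ}
    (hρ : 2 * K ^ 2 * latticeConst * (1 + envelopeConst (8 * τ) ς) *
        Real.exp (-τ / paramA P ^ 2) ≤ ρ) :
    HasFrameBounds (system φ₀ φ P) (|P.det|⁻¹ * (A - ρ)) (|P.det|⁻¹ * (B + ρ)) := by
  have hS := latticeConst_pos
  have hE := envelopeConst_pos (δ := 8 * τ) (by positivity) ς
  have hρ0 : 0 ≤ ρ := le_trans (by positivity) hρ
  have hA := hcov.1
  have hB : 0 < B := hA.trans_le hcov.le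
  refine hasFrameBounds_of_coeffSum (fun f => ?_) (by positivity)
  have hR : totalRemainder φ₀ φ P f ≤ ENNReal.ofReal (|P.det|⁻¹ * (ρ * ‖f‖ ^ 2)) := by
    refine (totalRemainder_le hP hτ hς hK ha h₀ h f).trans ?_
    rw [← ENNReal.ofReal_mul (by positivity), ← ENNReal.ofReal_mul (by positivity)]
    refine ENNReal.ofReal_le_ofReal ?_
    gcongr
  constructor
  · have h1 := (le_coeffSum hP hcov f).trans (add_le_add_right hR _)
    rw [← ENNReal.ofReal_mul hA.le, ← ENNReal.ofReal_mul (by positivity)] at h1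
    have h2 : |P.det|⁻¹ * (A - ρ) * ‖f‖ ^ 2 =
        |P.det|⁻¹ * (A * ‖f‖ ^ 2) - |P.det|⁻¹ * (ρ * ‖f‖ ^ 2) := by ring
    rw [h2, ENNReal.ofReal_sub _ (by positivity)]
    exact tsub_le_iff_right.2 h1
  · refine (coeffSum_le hP hcov f).trans ((add_le_add_right hR _).trans (le_of_eq ?_))
    rw [← ENNReal.ofReal_mul hB.le, ← ENNReal.ofReal_mul (by positivity),
      ← ENNReal.ofReal_add (by positivity) (by positivity)]
    congr 1
    ring

theorem enorm_sq_le_of_decay {z : ℂ} {K m E : ℝ} (hm0 : 0 ≤ m) (hm1 : m ≤ 1) (hE : 0 ≤ E)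
    (h : ‖z‖ ≤ K * (m * E ^ 2)) (hE1 : E ≤ 1) : ‖z‖ₑ ^ 2 ≤ ENNReal.ofReal (K ^ 2 * (m * E)) := by
  rw [← ofReal_norm, ← ENNReal.ofReal_pow (norm_nonneg _)]
  refine ENNReal.ofReal_le_ofReal ((pow_le_pow_left₀ (norm_nonneg _) h 2).trans ?_)
  rw [mul_pow]
  refine mul_le_mul_of_nonneg_left ?_ (sq_nonneg K)
  have h1 : m * E ^ 2 ≤ m * E := mul_le_mul_of_nonneg_left (by nlinarith) hm0
  have h2 : m * E ^ 2 ≤ 1 := mul_le_one₀ hm1 (sq_nonneg _) (pow_le_one₀ hE hE1)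
  have h3 : 0 ≤ m * E ^ 2 := by positivity
  nlinarith

theorem exp_neg_mul_sq_eq (δ x : ℝ) :
    Real.exp (-δ * x ^ 2) = Real.exp (-(δ / 2) * x ^ 2) ^ 2 := by
  rw [← Real.exp_nat_mul]
  congr 1
  push_cast
  ring

/-- The lower covering constant is bounded in terms of the decay constants. -/
theorem Covering.lower_le {φ₀ φ : L2} {δ ς K A B : ℝ} (hδ : 0 < δ) (hς : 2 < ς)
    (hcov : Covering φ₀ φ A B) (h₀ : CoarseDecay φ₀ δ K) (h : WindowDecay φ δ ς K) :
    A ≤ K ^ 2 * (1 + envelopeConst δ ς) := by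
  have hE := envelopeConst_pos hδ ς
  have hexp1 : ∀ x : ℝ, Real.exp (-(δ / 2) * x ^ 2) ≤ 1 := fun x => by
    rw [Real.exp_le_one_iff]; nlinarith [sq_nonneg x]
  -- There are countably many pairs (j, k), and each invertible B_{j,k} pulls null sets back to null
  -- sets.
  have hall : ∀ᵐ ξ : Plane, ∀ (j : ℕ+) (k : Fin (2 ^ (j : ℕ))),
      ‖(𝓕 φ : L2) (act (matB j k) ξ)‖ₑ ^ 2 ≤
        ENNReal.ofReal (K ^ 2) * ENNReal.ofReal (envelope δ ς (act (matB j k) ξ)) := by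
    rw [ae_all_iff]
    intro j
    rw [ae_all_iff]
    intro k
    have hdet : (matB j k).det ≠ 0 := det_transpose_inv (det_matA_ne_zero j k)
    filter_upwards [(quasiMeasurePreserving_affineHomeo hdet 0).ae h] with ξ hξ
    rw [affineHomeo_apply, sub_zero, exp_neg_mul_sq_eq] at hξ
    rw [← ENNReal.ofReal_mul (sq_nonneg K)]
    exact enorm_sq_le_of_decay (by positivity) (min_le_left _ _) (Real.exp_nonneg _) hξ (hexp1 _)
  have hae : ∀ᵐ ξ : Plane, ENNReal.ofReal A ≤ ENNReal.ofReal (K ^ 2 * (1 + envelopeConst δ ς)) := by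
    filter_upwards [hcov.2, h₀, hall] with ξ h1 h2 h3
    refine h1.1.trans ?_
    rw [exp_neg_mul_sq_eq, ← one_mul (Real.exp _ ^ 2)] at h2
    have h4 := enorm_sq_le_of_decay zero_le_one le_rfl (Real.exp_nonneg _) h2 (hexp1 _)
    rw [mul_add, ENNReal.ofReal_add (by positivity) (by positivity), coveringSum]
    refine add_le_add ?_ ?_
    · refine h4.trans (ENNReal.ofReal_le_ofReal ?_)
      rw [one_mul]
      exact mul_le_mul_of_nonneg_left (hexp1 _) (sq_nonneg K)
    · calc _ ≤ ∑' j : ℕ+, ∑ k : Fin (2 ^ (j : ℕ)), ENNReal.ofReal (K ^ 2) *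
            ENNReal.ofReal (envelope δ ς (act (matB j k) ξ)) :=
          ENNReal.tsum_le_tsum fun j => Finset.sum_le_sum fun k _ => h3 j k
        _ = ENNReal.ofReal (K ^ 2) * ∑' j : ℕ+, ∑ k : Fin (2 ^ (j : ℕ)),
            ENNReal.ofReal (envelope δ ς (act (matB j k) ξ)) := by
          simp only [← ENNReal.tsum_mul_left, Finset.mul_sum]
        _ ≤ _ := by
          rw [ENNReal.ofReal_mul (sq_nonneg K)]
          gcongr
          exact tsum_envelope_act_matB_le hδ hς ξ
  obtain ⟨ξ, hξ⟩ := hae.exists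
  exact (ENNReal.ofReal_le_ofReal_iff (by positivity)).1 hξ

theorem paramA_sq_le_of_kappa_le {τ : ℝ} (hP : P.det ≠ 0)
    (h : kappa τ P ≤ Real.exp (-1)) : paramA P ^ 2 ≤ τ := by
  have hp := paramA_pos hP
  have h1 : Real.exp (-τ / paramA P ^ 2) ≤ Real.exp (-1) :=
    (le_add_of_nonneg_right (Real.exp_nonneg _)).trans h
  rw [Real.exp_le_exp, neg_div, neg_le_neg_iff, le_div_iff₀ (by positivity), one_mul] at h1
  exact h1

/-- Nonvanishing of u matters: at u x = 0 the quotient is 0 by convention and the exponential is 1.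
-/
theorem tendsto_exp_neg_div_sq {τ : ℝ} (hτ : 0 < τ) {α : Type*} {l : Filter α} {u : α → ℝ}
    (hu : Tendsto u l (𝓝 0)) (hne : ∀ᶠ x in l, u x ≠ 0) :
    Tendsto (fun x => Real.exp (-τ / u x ^ 2)) l (𝓝 0) := by
  refine Real.tendsto_exp_atBot.comp ?_
  have h1 : Tendsto (fun x => u x ^ 2) l (𝓝[>] 0) := by
    refine tendsto_nhdsWithin_iff.2 ⟨by simpa using hu.pow 2, hne.mono fun x hx => ?_⟩
    exact sq_pos_of_ne_zero hx
  have h2 := (tendsto_inv_nhdsGT_zero.comp h1).const_mul_atTop_of_neg (neg_lt_zero.2 hτ)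
  simpa [div_eq_mul_inv] using h2

theorem tendsto_kappa {τ : ℝ} (hτ : 0 < τ) : Tendsto (kappa τ) fineLattices (𝓝 0) := by
  have h0 : Tendsto (fun P => (paramA P, paramB P)) fineLattices (𝓝 (0, 0)) :=
    tendsto_comap.mono_left inf_le_left
  rw [Prod.tendsto_iff] at h0
  have hdet : ∀ᶠ P in fineLattices, P.det ≠ 0 := by
    refine Filter.Eventually.filter_mono inf_le_right ?_
    exact mem_principal_self _
  have hA := tendsto_exp_neg_div_sq hτ h0.1 (hdet.mono fun P hP => (paramA_pos hP).ne')
  have hB := tendsto_exp_neg_div_sq hτ h0.2 (hdet.mono fun P hP => (paramB_pos hP).ne')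
  have := hA.add hB
  rwa [add_zero] at this

theorem tendsto_upperBound_div_lowerBound {τ C A B : ℝ} (hτ : 0 < τ) (hA : 0 < A) :
    Tendsto (fun P => upperBound B C τ P / lowerBound A C τ P) fineLattices (𝓝 (B / A)) := by
  have hκ := (tendsto_kappa hτ).const_mul C⁻¹
  rw [mul_zero] at hκ
  have h1 : Tendsto (fun P => (B + C⁻¹ * kappa τ P) / (A - C⁻¹ * kappa τ P)) fineLattices
      (𝓝 (B / A)) := by
    have := (hκ.const_add B).div (hκ.const_sub A) (by simpa using hA.ne')
    rwa [add_zero, sub_zero] at this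
  refine h1.congr' ?_
  have hdet : ∀ᶠ P in fineLattices, P.det ≠ 0 := by
    refine Filter.Eventually.filter_mono inf_le_right ?_
    exact mem_principal_self _
  filter_upwards [hdet] with P hP
  rw [upperBound, lowerBound, latticeVolume,
    mul_div_mul_left _ _ (inv_ne_zero (abs_ne_zero.2 hP))]

end frame

end

end Wavepacket

/-! ### The theorem: choice of constants -/

theorem mainTheorem2 (δ ς : ℝ) (hδ : 0 < δ) (hς : 2 < ς) :
    ∃ τ : ℝ, 0 < τ ∧ ∀ K : ℝ, 0 < K → ∃ C : ℝ, 0 < C ∧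
      ∀ (φ₀ φ : Wavepacket.L2) (A B : ℝ),
        Wavepacket.Covering φ₀ φ A B →
        Wavepacket.CoarseDecay φ₀ δ K →
        Wavepacket.WindowDecay φ δ ς K →
        (∀ P : Matrix (Fin 2) (Fin 2) ℝ, P.det ≠ 0 → Wavepacket.kappa τ P ≤ C * A →
          Wavepacket.IsFrame (Wavepacket.system φ₀ φ P) ∧
          Wavepacket.HasFrameBounds (Wavepacket.system φ₀ φ P)
            (Wavepacket.lowerBound A C τ P) (Wavepacket.upperBound B C τ P)) ∧
        Tendsto (fun P => Wavepacket.upperBound B C τ P / Wavepacket.lowerBound A C τ P)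
          Wavepacket.fineLattices (𝓝 (B / A)) := by
  -- The product of shifted windows retains exp(-δ |μ|² / 4) = exp(-2 τ |μ|²); half of this exponent
  -- yields exp(-τ / a²), the other half sums over the lattice.
  obtain ⟨τ, rfl⟩ : ∃ τ, δ = 8 * τ := ⟨δ / 8, by ring⟩
  have hτ : 0 < τ := by linarith
  refine ⟨τ, hτ, fun K hK => ?_⟩
  have hS := Wavepacket.latticeConst_pos
  have hE := Wavepacket.envelopeConst_pos hδ ς
  set S := Wavepacket.latticeConst
  set E := Wavepacket.envelopeConst (8 * τ) ς
  -- This is C⁻¹. The term e makes κ ≤ C A imply κ ≤ exp(-1), because A ≤ K² (1 + E), and hence a² ≤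
  -- τ. The term 4 S is twice the 2 S of the error bound, so the true error is at most c κ / 2.
  set c := K ^ 2 * (1 + E) * (Real.exp 1 + 4 * S) with hc
  have hcp : 0 < c := by positivity
  refine ⟨c⁻¹, inv_pos.2 hcp, fun φ₀ φ A B hcov h₀ h => ⟨fun P hP hκ => ?_,
    Wavepacket.tendsto_upperBound_div_lowerBound hτ hcov.1⟩⟩
  have hA := hcov.1
  have hB : 0 < B := hA.trans_le hcov.le
  have hAle : A ≤ K ^ 2 * (1 + E) := hcov.lower_le hδ hς h₀ h
  have hcκ : c * Wavepacket.kappa τ P ≤ A := by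
    rwa [inv_mul_eq_div, le_div_iff₀ hcp, mul_comm] at hκ
  have hκ0 : 0 ≤ Wavepacket.kappa τ P := add_nonneg (Real.exp_nonneg _) (Real.exp_nonneg _)
  have hexp : Wavepacket.kappa τ P ≤ Real.exp (-1) := by
    rw [Real.exp_neg, ← one_div, le_div_iff₀ (Real.exp_pos 1)]
    have h1 : K ^ 2 * (1 + E) * (Real.exp 1 * Wavepacket.kappa τ P) ≤ K ^ 2 * (1 + E) * 1 := by
      have h2 : 0 ≤ K ^ 2 * (1 + E) * (4 * S) * Wavepacket.kappa τ P := by positivity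
      rw [hc] at hcκ
      nlinarith
    have := le_of_mul_le_mul_left h1 (by positivity)
    linarith
  have ha := Wavepacket.paramA_sq_le_of_kappa_le hP hexp
  have hρ : 2 * K ^ 2 * S * (1 + E) * Real.exp (-τ / Wavepacket.paramA P ^ 2) ≤
      c * Wavepacket.kappa τ P / 2 := by
    have h1 : Real.exp (-τ / Wavepacket.paramA P ^ 2) ≤ Wavepacket.kappa τ P :=
      le_add_of_nonneg_right (Real.exp_nonneg _)
    have h2 : 0 ≤ K ^ 2 * (1 + E) * Real.exp 1 * Wavepacket.kappa τ P := by positivity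
    calc _ ≤ 2 * K ^ 2 * S * (1 + E) * Wavepacket.kappa τ P := by gcongr
      _ ≤ _ := by rw [hc]; nlinarith
  have hframe := Wavepacket.hasFrameBounds_system hP hτ hς hK ha hcov h₀ h hρ
  have hcκ0 : 0 ≤ c * Wavepacket.kappa τ P := by positivity
  have hPd : 0 < |P.det| := abs_pos.2 hP
  -- The lower bound with c κ may vanish when κ = C A. Using c κ / 2 leaves at least A / 2, so the
  -- frame constants are positive even then.
  refine ⟨⟨_, _, ?_, ?_, hframe⟩, hframe.mono ?_ ?_⟩
  · exact mul_pos (inv_pos.2 hPd) (by linarith)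
  · exact mul_pos (inv_pos.2 hPd) (by linarith)
  · rw [Wavepacket.lowerBound, Wavepacket.latticeVolume, inv_inv]
    exact mul_le_mul_of_nonneg_left (by linarith) (inv_pos.2 hPd).le
  · rw [Wavepacket.upperBound, Wavepacket.latticeVolume, inv_inv]
    exact mul_le_mul_of_nonneg_left (by linarith) (inv_pos.2 hPd).le
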